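/- Theorem (maximum likelihood estimators in the four-spin model, region $R_2$). For $n\ge 1$ and $\omega\in\Omega_n=\{1,-1\}^n$ put $\bar\omega_+=\frac1n|\{i:\omega_i=1\}|$, and for $\beta,h\in\mathbb R$ let $$\mu_{n,\beta,h}(\omega)=\frac{\exp\left(n f_{\beta,h}(\bar\omega_+)\right)}{\sum_{\omega'\in\Omega_n}\exp\left(n f_{\beta,h}(\bar\omega'_+)\right)},\qquad f_{\beta,h}(a)=\beta(2a-1)^4+h(2a-1)^2 .$$ With $E(s)=-\frac{1+s}{2}\log(1+s)-\frac{1-s}{2}\log(1-s)$ and $0\log 0=0$, let $$g(\beta)=\inf_{s\in[-1,1],\,s\ne0}\left(-\frac{E(s)}{s^2}-\beta s^2\right),\qquad R_2=\{(\beta,h):\beta>0,\ h>g(\beta)\}.$$ Let $(\beta,h)\in R_2$ and let $\omega$ be a sample from $\mu_{n,\beta,h}$. Let $\hat\beta_n=\hat\beta_n(\omega)$ be a maximum likelihood estimator of $\beta$ when $h$ is known, i.e. $\hat\beta_n(\omega)$ maximizes $b\mapsto\mu_{n,b,h}(\omega)$ over $\mathbb R$ whenever a maximizer exists (and is an arbitrary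 real number otherwise); likewise let $\hat h_n$ be a maximum likelihood estimator of $h$ when $\beta$ is known, i.e. $\hat h_n(\omega)$ maximizes $k\mapsto\mu_{n,\beta,k}(\omega)$ over $\mathbb R$ whenever a maximizer exists. Then, as $n\to\infty$, $$\sqrt n(\hat\beta_n-\beta)\xrightarrow{\ \mathcal L\ }U_\beta,\qquad \sqrt n(\hat h_n-h)\xrightarrow{\ \mathcal L\ }U_h,$$ where, for $\nu\in\{\beta,h\}$, the law of $U_\nu$ is the mixture $$p_\nu^-\,N^-(0,\sigma_\nu^-)+p_\nu^+\,N^+(0,\sigma_\nu^+)+(1-p_\nu^--p_\nu^+)\,\delta_0$$ for some constants $p_\nu^\pm>0$, $\sigma_\nu^\pm>0$ with $p_\nu^-+p_\nu^+\le1$ (depending on $(\beta,h)$). Here $N^+(0,a)$ and $N^-(0,a)$ are the laws of $|Z|$ and $-|Z|$ for $Z\sim N(0,a)$, a centred normal variable with variance $a$. -/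

import Mathlib

open MeasureTheory ProbabilityTheory Filter
open scoped NNReal ENNReal

noncomputable section

namespace FourSpin

/-- Spin configurations: `ℤˣ = {1, -1}`. -/
abbrev Config (n : ℕ) : Type := Fin n → ℤˣ

/-- The fraction `|{i : ω i = 1}| / n` of plus spins. -/
def plusFraction {n : ℕ} (ω : Config n) : ℝ :=
  ((Finset.univ.filter fun i => ω i = 1).card : ℝ) / (n : ℝ)

/-- `f_{β,h}(a) = β (2a - 1)^4 + h (2a - 1)^2`. -/
def energy (β h a : ℝ) : ℝ := β * (2 * a - 1) ^ 4 + h * (2 * a - 1) ^ 2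

/-- The Hamiltonian `H_n(ω) = n f_{β,h}(plusFraction ω)`. -/
def hamiltonian (n : ℕ) (β h : ℝ) (ω : Config n) : ℝ :=
  (n : ℝ) * energy β h (plusFraction ω)

/-- The partition function. -/
def partitionFunction (n : ℕ) (β h : ℝ) : ℝ :=
  ∑ ω : Config n, Real.exp (hamiltonian n β h ω)

/-- The Gibbs probability of a configuration; as a function of a parameter, the likelihood. -/
def gibbsProb (n : ℕ) (β h : ℝ) (ω : Config n) : ℝ :=
  Real.exp (hamiltonian n β h ω) / partitionFunction n β h

/-- The Gibbs measure on configurations. -/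
def gibbsMeasure (n : ℕ) (β h : ℝ) : Measure (Config n) :=
  ∑ ω : Config n, ENNReal.ofReal (gibbsProb n β h ω) • Measure.dirac ω

theorem partitionFunction_pos (n : ℕ) (β h : ℝ) : 0 < partitionFunction n β h :=
  Finset.sum_pos (fun _ _ => Real.exp_pos _) Finset.univ_nonempty

instance gibbsMeasure_isProbabilityMeasure (n : ℕ) (β h : ℝ) :
    IsProbabilityMeasure (gibbsMeasure n β h) := by
  constructor
  have h0 : ∀ ω ∈ (Finset.univ : Finset (Config n)), 0 ≤ gibbsProb n β h ω := fun ω _ =>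
    div_nonneg (Real.exp_pos _).le (partitionFunction_pos n β h).le
  have h1 : ∑ ω : Config n, gibbsProb n β h ω = 1 := by
    unfold gibbsProb
    rw [← Finset.sum_div]
    exact div_self (partitionFunction_pos n β h).ne'
  simp only [gibbsMeasure, Measure.coe_finsetSum, Finset.sum_apply, Measure.smul_apply,
    measure_univ, smul_eq_mul, mul_one]
  rw [← ENNReal.ofReal_sum_of_nonneg h0, h1, ENNReal.ofReal_one]

/-- `θ` maximizes over all of `ℝ` the likelihood `θ' ↦ L θ' ω` of the observation `ω`. -/
def IsMLE {Ω : Type*} (L : ℝ → Ω → ℝ) (ω : Ω) (θ : ℝ) : Prop :=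
  ∀ θ' : ℝ, L θ' ω ≤ L θ ω

/-- `T` is a maximum likelihood estimator: `T ω` maximizes the likelihood of `ω` for every
observation `ω` for which a maximizer exists. Its value at other observations is arbitrary. -/
def IsMLEstimator {Ω : Type*} (L : ℝ → Ω → ℝ) (T : Ω → ℝ) : Prop :=
  ∀ ω : Ω, (∃ θ : ℝ, IsMLE L ω θ) → IsMLE L ω (T ω)

/-- `E(t) = -((1+t)/2) log (1+t) - ((1-t)/2) log (1-t)`, with `0 log 0 = 0`. -/
def spinEntropy (t : ℝ) : ℝ :=
  -((1 + t) / 2) * Real.log (1 + t) - ((1 - t) / 2) * Real.log (1 - t)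

/-- The critical curve `g(β) = inf_s (-E(s)/s² - β s²)` over `s ∈ [-1, 1]`. The point `s = 0`,
where the function is only defined by continuity, does not affect the infimum and is left out. -/
def criticalCurve (β : ℝ) : ℝ :=
  sInf ((fun s : ℝ => -spinEntropy s / s ^ 2 - β * s ^ 2) '' (Set.Icc (-1) 1 \ {0}))

/-- The region `R₂ = {(β, h) : β > 0, h > g(β)}`. -/
def regionTwo : Set (ℝ × ℝ) := {x | 0 < x.1 ∧ criticalCurve x.1 < x.2}

/-- The positive half-normal law `N⁺(0, v)`: the law of `|Z|`, where `Z ∼ N(0, v)`. -/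
def posHalfNormal (v : ℝ≥0) : Measure ℝ := (gaussianReal 0 v).map fun x => |x|

/-- The negative half-normal law `N⁻(0, v)`: the law of `-|Z|`, where `Z ∼ N(0, v)`. -/
def negHalfNormal (v : ℝ≥0) : Measure ℝ := (gaussianReal 0 v).map fun x => -|x|

/-- The measure `p N⁻(0, v) + q N⁺(0, w) + (1 - p - q) δ₀`. -/
def halfNormalMixture (p q : ℝ) (v w : ℝ≥0) : Measure ℝ :=
  ENNReal.ofReal p • negHalfNormal v + ENNReal.ofReal q • posHalfNormal w +
    ENNReal.ofReal (1 - p - q) • Measure.dirac 0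

/-- Under the four-spin Gibbs measures with parameters `(β, h)`, the random variables `X n`
converge in law to `p N⁻(0, v) + q N⁺(0, w) + (1 - p - q) δ₀` for some constants
`p, q, v, w > 0` with `p + q ≤ 1`. -/
def ConvergesToHalfNormalMixture (β h : ℝ) (X : (n : ℕ) → Config n → ℝ) : Prop :=
  ∃ (p q : ℝ) (v w : ℝ≥0) (U : ProbabilityMeasure ℝ),
    0 < p ∧ 0 < q ∧ p + q ≤ 1 ∧ 0 < v ∧ 0 < w ∧
    (U : Measure ℝ) = halfNormalMixture p q v w ∧
    TendstoInDistribution X atTop (fun x : ℝ => x) (fun n => gibbsMeasure n β h) (U : Measure ℝ)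

end FourSpin

end

noncomputable section

namespace FourSpin

open Set Topology

/-! ### The rate function and its maximizer -/

/-! The Gibbs weight depends on `ω` only through its magnetization `m`, and about `2^n exp (n E(m))`
configurations share a given `m`. The mass at `m` therefore grows like `2^n exp (n rate(m))`. The
condition `h > g(β)` says that the rate is positive somewhere, so its maximum over `[0, 1]` is not
at `0`. Divided by `x`, the derivative of the rate is a concave function of `x ^ 2`. This makes the
maximizer `s` unique and nondegenerate (`exists_unique_maximizer`).

The mass concentrates near `s` and `-s`. The sufficient statistic `u(m)`, namely `m ^ 4` for `β` and
`m ^ 2` for `h`, is even, so both wells contribute equally. Near `s` the Gibbs weight is, up to a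
constant, the law of independent spins of mean `s` times the exponential of a quadratic expression
in `√n (m - s)`: criticality removes the linear term. The central limit theorem for independent
spins, exponential moment bounds and a crude estimate away from the wells give
`tendsto_gibbsSum_div`. Hence `Y = √n (u(m) - u(s))` is asymptotically `N(0, v)`, and its
exponential moments converge too.

In the local parameter `t = √n (θ - θ₀)` the likelihood is proportional to `1 / J(t)`. Here `J` is
convex and close to `exp (v t² / 2 - t Y)`, so its minimizer is close to `Y / v`
(`eventually_abs_estimator_sub_le`). The rescaled estimator thus converges to `N(0, 1 / v)`. This is
the mixture of the two half-normal laws of variance `1 / v` with weights `1 / 2` and no atom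
(`halfNormalMixture_half`). -/

/-- The exponential growth rate of the weight of configurations with magnetization `x`. -/
def rate (β h x : ℝ) : ℝ := β * x ^ 4 + h * x ^ 2 + spinEntropy x

theorem spinEntropy_eq_negMulLog (t : ℝ) :
    spinEntropy t = (Real.negMulLog (1 + t) + Real.negMulLog (1 - t)) / 2 := by
  unfold spinEntropy Real.negMulLog; ring

theorem continuous_spinEntropy : Continuous spinEntropy := by
  rw [show spinEntropy = _ from funext spinEntropy_eq_negMulLog]
  have h1 : Continuous fun t : ℝ => Real.negMulLog (1 + t) :=
    Real.continuous_negMulLog.comp (by fun_prop)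
  have h2 : Continuous fun t : ℝ => Real.negMulLog (1 - t) :=
    Real.continuous_negMulLog.comp (by fun_prop)
  exact (h1.add h2).div_const 2

theorem continuous_rate (β h : ℝ) : Continuous (rate β h) := by
  have := continuous_spinEntropy
  unfold rate; fun_prop

theorem spinEntropy_neg (t : ℝ) : spinEntropy (-t) = spinEntropy t := by
  simp only [spinEntropy_eq_negMulLog, sub_neg_eq_add, ← sub_eq_add_neg]; ring

theorem rate_neg (β h x : ℝ) : rate β h (-x) = rate β h x := by
  simp only [rate, spinEntropy_neg]; ring

theorem rate_abs (β h x : ℝ) : rate β h |x| = rate β h x := by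
  rcases abs_choice x with hx | hx <;> rw [hx]
  exact rate_neg β h x

theorem rate_zero (β h : ℝ) : rate β h 0 = 0 := by
  simp [rate, spinEntropy_eq_negMulLog, Real.negMulLog]

/-- The inverse hyperbolic tangent. -/
def halfLogOdds (x : ℝ) : ℝ := (Real.log (1 + x) - Real.log (1 - x)) / 2

theorem hasDerivAt_halfLogOdds {x : ℝ} (h1 : -1 < x) (h2 : x < 1) :
    HasDerivAt halfLogOdds (1 / (1 - x ^ 2)) x := by
  have a1 : (1 + x) ≠ 0 := by linarith
  have a2 : (1 - x) ≠ 0 := by linarith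
  have d1 : HasDerivAt (fun y : ℝ => Real.log (1 + y)) (1 / (1 + x)) x :=
    ((hasDerivAt_id x).const_add 1).log a1
  have d2 : HasDerivAt (fun y : ℝ => Real.log (1 - y)) (-1 / (1 - x)) x :=
    ((hasDerivAt_id x).const_sub 1).log a2
  refine ((d1.sub d2).div_const 2).congr_deriv ?_
  have : 1 - x ^ 2 ≠ 0 := by
    rw [show 1 - x ^ 2 = (1 + x) * (1 - x) by ring]; exact mul_ne_zero a1 a2
  field_simp
  ring

theorem hasDerivAt_spinEntropy {x : ℝ} (h1 : -1 < x) (h2 : x < 1) :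
    HasDerivAt spinEntropy (-halfLogOdds x) x := by
  have a1 : (1 + x) ≠ 0 := by linarith
  have a2 : (1 - x) ≠ 0 := by linarith
  have d1 : HasDerivAt (fun y : ℝ => Real.negMulLog (1 + y)) (-Real.log (1 + x) - 1) x := by
    refine ((Real.hasDerivAt_negMulLog a1).comp x
      ((hasDerivAt_id x).const_add 1)).congr_deriv ?_
    ring
  have d2 : HasDerivAt (fun y : ℝ => Real.negMulLog (1 - y)) (Real.log (1 - x) + 1) x := by
    refine ((Real.hasDerivAt_negMulLog a2).comp x
      ((hasDerivAt_id x).const_sub 1)).congr_deriv ?_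
    ring
  rw [show spinEntropy = _ from funext spinEntropy_eq_negMulLog]
  refine ((d1.add d2).div_const 2).congr_deriv ?_
  unfold halfLogOdds; ring

/-- The derivative of the rate function. -/
def rateDeriv (β h x : ℝ) : ℝ := 4 * β * x ^ 3 + 2 * h * x - halfLogOdds x

theorem hasDerivAt_rate (β h : ℝ) {x : ℝ} (h1 : -1 < x) (h2 : x < 1) :
    HasDerivAt (rate β h) (rateDeriv β h x) x := by
  have d1 : HasDerivAt (fun y : ℝ => β * y ^ 4 + h * y ^ 2) (4 * β * x ^ 3 + 2 * h * x) x := by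
    refine (((hasDerivAt_pow 4 x).const_mul β).add
      ((hasDerivAt_pow 2 x).const_mul h)).congr_deriv ?_
    norm_num; ring
  exact (d1.add (hasDerivAt_spinEntropy h1 h2)).congr_deriv (by unfold rateDeriv; ring)

theorem hasDerivAt_rateDeriv (β h : ℝ) {x : ℝ} (h1 : -1 < x) (h2 : x < 1) :
    HasDerivAt (rateDeriv β h) (12 * β * x ^ 2 + 2 * h - 1 / (1 - x ^ 2)) x := by
  have d1 : HasDerivAt (fun y : ℝ => 4 * β * y ^ 3 + 2 * h * y) (12 * β * x ^ 2 + 2 * h) x := by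
    refine (((hasDerivAt_pow 3 x).const_mul (4 * β)).add
      ((hasDerivAt_id x).const_mul (2 * h))).congr_deriv ?_
    norm_num; ring
  exact d1.sub (hasDerivAt_halfLogOdds h1 h2)

/-- The function `t ↦ artanh √t / √t`, as a power series. -/
def artanhSeries (t : ℝ) : ℝ := ∑' k : ℕ, t ^ k / (2 * k + 1)

theorem summable_artanhSeries {t : ℝ} (h0 : 0 ≤ t) (h1 : t < 1) :
    Summable fun k : ℕ => t ^ k / (2 * k + 1) := by
  refine Summable.of_nonneg_of_le (fun k => by positivity) (fun k => ?_)
    (summable_geometric_of_lt_one h0 h1)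
  refine div_le_self (by positivity) ?_
  have : (0 : ℝ) ≤ k := by positivity
  linarith

/-- The Taylor series of artanh is odd; taking out one factor `x` leaves a series in `x ^ 2`. -/
theorem halfLogOdds_eq {x : ℝ} (h0 : 0 ≤ x) (h1 : x < 1) :
    halfLogOdds x = x * artanhSeries (x ^ 2) := by
  have hs := Real.hasSum_log_sub_log_of_abs_lt_one (x := x) (by rw [abs_of_nonneg h0]; exact h1)
  have h2 := ((summable_artanhSeries (t := x ^ 2) (by positivity)
    (by nlinarith)).hasSum.mul_left x).mul_left 2
  have h3 := hs.unique (h2.congr_fun ?_)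
  · unfold halfLogOdds; rw [h3]; unfold artanhSeries; ring
  · intro k; rw [← pow_mul]; ring

/-- Every term is a nonnegative multiple of a power, hence convex on `[0, ∞)`. -/
theorem convexOn_artanhSeries : ConvexOn ℝ (Ico 0 1) artanhSeries := by
  refine ⟨convex_Ico 0 1, fun a ha b hb p q hp hq hpq => ?_⟩
  have hc := convex_Ico (0 : ℝ) 1 ha hb hp hq hpq
  have sa := (summable_artanhSeries ha.1 ha.2).hasSum.mul_left p
  have sb := (summable_artanhSeries hb.1 hb.2).hasSum.mul_left q
  refine hasSum_le (fun k => ?_) (summable_artanhSeries hc.1 hc.2).hasSum (sa.add sb)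
  have := (convexOn_pow k).2 (show a ∈ Ici 0 from ha.1) (show b ∈ Ici 0 from hb.1) hp hq hpq
  simp only [smul_eq_mul] at this ⊢
  rw [← mul_div_assoc, ← mul_div_assoc, ← add_div]
  gcongr

/-- `rateDeriv β h x = x * reducedDeriv β h (x ^ 2)`. -/
def reducedDeriv (β h t : ℝ) : ℝ := 4 * β * t + 2 * h - artanhSeries t

theorem rateDeriv_eq (β h : ℝ) {x : ℝ} (h0 : 0 ≤ x) (h1 : x < 1) :
    rateDeriv β h x = x * reducedDeriv β h (x ^ 2) := by
  unfold rateDeriv reducedDeriv; rw [halfLogOdds_eq h0 h1]; ring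

/-- Affine minus convex. Concavity in `t = x ^ 2` prevents the derivative of the rate from becoming
positive again after it has passed from positive values to `0`. -/
theorem concaveOn_reducedDeriv (β h : ℝ) : ConcaveOn ℝ (Ico 0 1) (reducedDeriv β h) := by
  refine ⟨convex_Ico 0 1, fun a ha b hb p q hp hq hpq => ?_⟩
  have := convexOn_artanhSeries.2 ha hb hp hq hpq
  simp only [smul_eq_mul, reducedDeriv] at this ⊢
  have e : h * 2 = p * (h * 2) + q * (h * 2) := by rw [← add_mul, hpq, one_mul]
  nlinarith

/-- To the right of a positive maximizer on `[0, 1]` at which the rate exceeds `0`, the derivative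
of the rate is bounded above by a negative multiple of `x (x² - s²)`. -/
theorem exists_rateDeriv_le {β h s : ℝ} (hs0 : 0 < s) (hs1 : s < 1) (hpos : 0 < rate β h s)
    (hd : rateDeriv β h s = 0) :
    ∃ c > 0, ∀ x, s < x → x < 1 → rateDeriv β h x ≤ -(c * x * (x ^ 2 - s ^ 2)) := by
  -- The rate climbs from `0` at `0` to a positive value at `s`, so the mean value theorem yields a
  -- point of positive derivative before `s`.
  obtain ⟨r, hr, hrd⟩ := exists_hasDerivAt_eq_slope (rate β h) (rateDeriv β h) hs0
    (continuous_rate β h).continuousOn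
    (fun x hx => hasDerivAt_rate β h (by linarith [hx.1]) (by linarith [hx.2]))
  rw [rate_zero, sub_zero, sub_zero] at hrd
  have hr1 : r < 1 := hr.2.trans hs1
  have hGs : reducedDeriv β h (s ^ 2) = 0 := by
    rw [rateDeriv_eq β h hs0.le hs1] at hd
    exact (mul_eq_zero.mp hd).resolve_left hs0.ne'
  have hGr : 0 < reducedDeriv β h (r ^ 2) := by
    have : 0 < r * reducedDeriv β h (r ^ 2) := by
      rw [← rateDeriv_eq β h hr.1.le hr1, hrd]; positivity
    exact (mul_pos_iff_of_pos_left hr.1).mp this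
  have hrs : r ^ 2 < s ^ 2 := by nlinarith [hr.1, hr.2]
  -- `-c` is the slope of the chord of `reducedDeriv` from `r ^ 2` to its zero `s ^ 2`; by
  -- concavity, chords further right are at least as steep downwards.
  refine ⟨reducedDeriv β h (r ^ 2) / (s ^ 2 - r ^ 2), div_pos hGr (by linarith),
    fun x hx hx1 => ?_⟩
  have hsx : s ^ 2 < x ^ 2 := by nlinarith
  have key := (concaveOn_reducedDeriv β h).slope_anti_adjacent (x := r ^ 2) (y := s ^ 2)
    (z := x ^ 2) ⟨by positivity, by nlinarith [hr.1]⟩ ⟨by positivity, by nlinarith⟩ hrs hsx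
  rw [hGs, sub_zero, zero_sub, div_le_iff₀ (by linarith), neg_div] at key
  rw [rateDeriv_eq β h (by linarith) hx1]
  nlinarith [mul_le_mul_of_nonneg_left key (show 0 ≤ x by linarith)]

theorem rate_lt_of_lt {β h s : ℝ} (hs0 : 0 < s) (hs1 : s < 1) (hpos : 0 < rate β h s)
    (hd : rateDeriv β h s = 0) {x : ℝ} (hsx : s < x) (hx : x ≤ 1) : rate β h x < rate β h s := by
  obtain ⟨c, hc, hle⟩ := exists_rateDeriv_le hs0 hs1 hpos hd
  have anti : StrictAntiOn (rate β h) (Icc s 1) := by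
    refine strictAntiOn_of_deriv_neg (convex_Icc s 1) (continuous_rate β h).continuousOn ?_
    intro y hy
    rw [interior_Icc] at hy
    rw [(hasDerivAt_rate β h (by linarith [hy.1]) hy.2).deriv]
    have h1 := hle y hy.1 hy.2
    have : 0 < c * y * (y ^ 2 - s ^ 2) :=
      mul_pos (mul_pos hc (hs0.trans hy.1)) (by nlinarith [hy.1])
    linarith
  exact anti ⟨le_rfl, hs1.le⟩ ⟨hsx.le, hx⟩ hsx

/-- The sum of the derivative of the rate and `c x (x² - s²)` vanishes at `s` and is nonpositive to
its right, so its slope at `s` is nonpositive. The added term has slope `2 c s² > 0`, which makes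
the inequality strict. -/
theorem second_deriv_neg {β h s : ℝ} (hs0 : 0 < s) (hs1 : s < 1) (hpos : 0 < rate β h s)
    (hd : rateDeriv β h s = 0) : 12 * β * s ^ 2 + 2 * h < 1 / (1 - s ^ 2) := by
  obtain ⟨c, hc, hle⟩ := exists_rateDeriv_le hs0 hs1 hpos hd
  have d1 := hasDerivAt_rateDeriv β h (x := s) (by linarith) hs1
  have d2 : HasDerivAt (fun x : ℝ => c * x * (x ^ 2 - s ^ 2)) (2 * c * s ^ 2) s := by
    refine (((hasDerivAt_id s).const_mul c).mul
      ((hasDerivAt_pow 2 s).sub_const (s ^ 2))).congr_deriv ?_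
    simp; ring
  have d3 := (d1.add d2).hasDerivWithinAt (s := Ioi s)
  rw [hasDerivWithinAt_iff_tendsto_slope' (by simp)] at d3
  have : 12 * β * s ^ 2 + 2 * h - 1 / (1 - s ^ 2) + 2 * c * s ^ 2 ≤ 0 := by
    refine le_of_tendsto d3 ?_
    filter_upwards [Ioo_mem_nhdsGT hs1] with x hx
    rw [slope_def_field]
    refine div_nonpos_of_nonpos_of_nonneg ?_ (by linarith [hx.1])
    have := hle x hx.1 hx.2
    simp only [Pi.add_apply, hd]
    linarith
  have : 0 < 2 * c * s ^ 2 := by positivity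
  linarith

/-- The rate function is not maximal at the endpoint `1`. -/
theorem exists_rate_one_lt {β h : ℝ} : ∃ x ∈ Ioo (0 : ℝ) 1, rate β h 1 < rate β h x := by
  -- Moving from `1` to `1 - e` costs the polynomial part at most `K e`. The entropy gains at least
  -- `-(e / 2) log e`, which this `e` makes equal to `(K + 1) e`.
  set K := 4 * |β| + 2 * |h| with hK
  have hK0 : 0 ≤ K := by positivity
  set e := Real.exp (-(2 * K + 2)) with he
  have e0 : 0 < e := Real.exp_pos _
  have e1 : e < 1 := by rw [he, Real.exp_lt_one_iff]; linarith
  refine ⟨1 - e, ⟨by linarith, by linarith⟩, ?_⟩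
  have hlog : Real.log e = -(2 * K + 2) := Real.log_exp _
  have hE1 : spinEntropy 1 = -Real.log 2 := by unfold spinEntropy; norm_num
  have hE2 : -Real.log 2 + (K + 1) * e ≤ spinEntropy (1 - e) := by
    unfold spinEntropy
    rw [show 1 - (1 - e) = e by ring, hlog, show 1 + (1 - e) = 2 - e by ring]
    have l2 : 0 ≤ Real.log (2 - e) := Real.log_nonneg (by linarith)
    have l3 : Real.log (2 - e) ≤ Real.log 2 := Real.log_le_log (by linarith) (by linarith)
    nlinarith
  have h4 : |β * 1 ^ 4 - β * (1 - e) ^ 4| ≤ 4 * |β| * e := by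
    rw [← mul_sub, abs_mul, show (1 : ℝ) ^ 4 - (1 - e) ^ 4
      = e * (1 + (1 - e) + (1 - e) ^ 2 + (1 - e) ^ 3) by ring, mul_comm 4, mul_assoc]
    refine mul_le_mul_of_nonneg_left ?_ (abs_nonneg _)
    have p1 : 0 ≤ 1 - e := by linarith
    rw [abs_of_nonneg (by positivity), mul_comm]
    have p2 : (1 - e) ^ 2 ≤ 1 := pow_le_one₀ p1 (by linarith)
    have p3 : (1 - e) ^ 3 ≤ 1 := pow_le_one₀ p1 (by linarith)
    exact mul_le_mul_of_nonneg_right (by linarith) e0.le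
  have h2 : |h * 1 ^ 2 - h * (1 - e) ^ 2| ≤ 2 * |h| * e := by
    rw [← mul_sub, abs_mul, show (1 : ℝ) ^ 2 - (1 - e) ^ 2 = e * (2 - e) by ring, mul_comm 2,
      mul_assoc]
    refine mul_le_mul_of_nonneg_left ?_ (abs_nonneg _)
    rw [abs_of_nonneg (mul_nonneg e0.le (by linarith))]
    nlinarith
  have h4' := (abs_le.mp h4).2
  have h2' := (abs_le.mp h2).2
  unfold rate
  rw [hE1]
  nlinarith

/-- Since `h` exceeds the infimum, some `x ≠ 0` satisfies `-E(x) / x² - β x² < h`; multiply by `x²`,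
and use evenness to pass to `|x|`. -/
theorem exists_rate_pos {β h : ℝ} (hβh : (β, h) ∈ regionTwo) :
    ∃ x ∈ Icc (0 : ℝ) 1, 0 < rate β h x := by
  obtain ⟨_, ⟨x, ⟨hx, hx0⟩, rfl⟩, hlt⟩ := exists_lt_of_csInf_lt
    (⟨_, ⟨1, by norm_num, rfl⟩⟩ : ((fun s : ℝ => -spinEntropy s / s ^ 2 - β * s ^ 2) ''
      (Icc (-1) 1 \ {0})).Nonempty) hβh.2
  refine ⟨|x|, ⟨abs_nonneg x, abs_le.mpr hx⟩, ?_⟩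
  rw [rate_abs]
  have hx2 : 0 < x ^ 2 := by
    have : x ≠ 0 := hx0
    positivity
  have h1 : -spinEntropy x / x ^ 2 < h + β * x ^ 2 := by simpa using by linarith
  rw [div_lt_iff₀ hx2] at h1
  unfold rate
  nlinarith

/-- In the region `R₂` the rate function has a unique maximizer on `[0, 1]`; it lies in `(0, 1)`
and is nondegenerate. -/
theorem exists_unique_maximizer {β h : ℝ} (hβh : (β, h) ∈ regionTwo) :
    ∃ s : ℝ, 0 < s ∧ s < 1 ∧ 4 * β * s ^ 3 + 2 * h * s = halfLogOdds s ∧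
      12 * β * s ^ 2 + 2 * h < 1 / (1 - s ^ 2) ∧
      ∀ x ∈ Icc (0 : ℝ) 1, x ≠ s → rate β h x < rate β h s := by
  obtain ⟨s, hs, hmax⟩ := isCompact_Icc.exists_isMaxOn (nonempty_Icc.mpr zero_le_one)
    (continuous_rate β h).continuousOn
  obtain ⟨x₀, hx₀, hx₀p⟩ := exists_rate_pos hβh
  obtain ⟨x₁, hx₁, hx₁p⟩ := exists_rate_one_lt (β := β) (h := h)
  have hpos : 0 < rate β h s := hx₀p.trans_le (hmax hx₀)
  have main : ∀ y ∈ Icc (0 : ℝ) 1, rate β h y = rate β h s →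
      0 < y ∧ y < 1 ∧ rateDeriv β h y = 0 := by
    intro y hy hye
    have y0 : 0 < y := by
      refine lt_of_le_of_ne hy.1 fun h0 => ?_
      rw [← h0, rate_zero] at hye; exact hpos.ne hye
    have y1 : y < 1 := by
      refine lt_of_le_of_ne hy.2 fun h0 => ?_
      rw [h0] at hye
      have : rate β h x₁ ≤ rate β h s := hmax ⟨hx₁.1.le, hx₁.2.le⟩
      linarith
    refine ⟨y0, y1, IsLocalMax.hasDerivAt_eq_zero (f := rate β h) (a := y) ?_
      (hasDerivAt_rate β h (by linarith) y1)⟩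
    filter_upwards [Icc_mem_nhds y0 y1] with z hz
    rw [hye]; exact hmax hz
  obtain ⟨s0, s1, sd⟩ := main s hs rfl
  refine ⟨s, s0, s1, by unfold rateDeriv at sd; linarith, second_deriv_neg s0 s1 hpos sd,
    fun x hx hxs => lt_of_le_of_ne (hmax hx) fun hxe => ?_⟩
  obtain ⟨x0, x1, xd⟩ := main x hx hxe
  -- Of two maximizers, the left one would strictly dominate everything to its right.
  rcases lt_or_gt_of_ne hxs with hlt | hlt
  · exact (rate_lt_of_lt x0 x1 (hxe ▸ hpos) xd hlt hs.2).ne hxe.symm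
  · exact (rate_lt_of_lt s0 s1 hpos sd hlt hx.2).ne hxe

/-! ### Weak convergence tested against unbounded functions -/

/-- A continuous cutoff function: `1` on `[-K, K]` and `0` outside `[-K - 1, K + 1]`. -/
def cutoff (K x : ℝ) : ℝ := max 0 (min 1 (K + 1 - |x|))

theorem continuous_cutoff (K : ℝ) : Continuous (cutoff K) := by
  unfold cutoff; fun_prop

theorem cutoff_nonneg (K x : ℝ) : 0 ≤ cutoff K x := le_max_left _ _

theorem cutoff_le_one (K x : ℝ) : cutoff K x ≤ 1 :=
  max_le zero_le_one (min_le_left _ _)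

theorem cutoff_eq_one {K x : ℝ} (hx : |x| ≤ K) : cutoff K x = 1 := by
  unfold cutoff
  rw [min_eq_left (by linarith), max_eq_right zero_le_one]

theorem cutoff_eq_zero {K x : ℝ} (hx : K + 1 ≤ |x|) : cutoff K x = 0 := by
  unfold cutoff
  exact max_eq_left ((min_le_right _ _).trans (by linarith))

/-- Markov's inequality in pointwise form: `1 - cutoff K x` vanishes for `|x| ≤ K` and is at most `1
≤ |x| / K` beyond. -/
theorem norm_sub_cutoff_mul_le {K x : ℝ} (hK : 0 < K) (z : ℂ) :
    ‖z - cutoff K x * z‖ ≤ ‖z‖ * |x| / K := by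
  have h0 := cutoff_nonneg K x
  have h1 := cutoff_le_one K x
  rw [show z - cutoff K x * z = ((1 - cutoff K x : ℝ) : ℂ) * z by push_cast; ring, norm_mul,
    Complex.norm_real, Real.norm_of_nonneg (by linarith), mul_comm, mul_div_assoc]
  refine mul_le_mul_of_nonneg_left ?_ (norm_nonneg _)
  rcases le_or_gt |x| K with hx | hx
  · rw [cutoff_eq_one hx, sub_self]; positivity
  · have : 1 ≤ |x| / K := (one_le_div hK).mpr hx.le
    linarith

/-- If `μ n → μ` weakly, `H n → H` locally uniformly and `∫ ‖H n x‖ |x| dμ n` is bounded, then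
`∫ H n dμ n → ∫ H dμ`. -/
theorem tendsto_integral_of_tendsto_of_moment_le {μ : ℕ → ProbabilityMeasure ℝ}
    {μ₀ : ProbabilityMeasure ℝ} (hμ : Tendsto μ atTop (𝓝 μ₀)) {H : ℕ → ℝ → ℂ} {H₀ : ℝ → ℂ}
    (hH₀ : Continuous H₀)
    (hunif : ∀ K : ℝ, TendstoUniformlyOn H H₀ atTop (Icc (-K) K))
    (hint : ∀ n, Integrable (H n) (μ n)) (hint' : ∀ n, Integrable (fun x => ‖H n x‖ * |x|) (μ n))
    (hint₀ : Integrable H₀ μ₀) (hint₀' : Integrable (fun x => ‖H₀ x‖ * |x|) μ₀)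
    {C : ℝ} (hC : ∀ n, ∫ x, ‖H n x‖ * |x| ∂(μ n : Measure ℝ) ≤ C) :
    Tendsto (fun n => ∫ x, H n x ∂(μ n : Measure ℝ)) atTop
      (𝓝 (∫ x, H₀ x ∂(μ₀ : Measure ℝ))) := by
  set C' := max C (∫ x, ‖H₀ x‖ * |x| ∂(μ₀ : Measure ℝ)) with hC'
  have tail : ∀ (ν : ProbabilityMeasure ℝ) (G : ℝ → ℂ), Integrable G ν →
      Integrable (fun x => ‖G x‖ * |x|) ν → ∫ x, ‖G x‖ * |x| ∂(ν : Measure ℝ) ≤ C' →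
      ∀ K > 0, ‖∫ x, G x ∂(ν : Measure ℝ) - ∫ x, cutoff K x * G x ∂(ν : Measure ℝ)‖ ≤ C' / K := by
    intro ν G hG hG' hle K hK
    have hcG : Integrable (fun x => (cutoff K x : ℂ) * G x) (ν : Measure ℝ) := by
      refine hG.bdd_mul (c := 1)
        (Complex.continuous_ofReal.comp (continuous_cutoff K)).aestronglyMeasurable ?_
      refine ae_of_all _ fun x => ?_
      rw [Complex.norm_real, Real.norm_of_nonneg (cutoff_nonneg K x)]
      exact cutoff_le_one K x
    rw [← integral_sub hG hcG]
    calc _ ≤ ∫ x, ‖G x‖ * |x| / K ∂(ν : Measure ℝ) :=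
          norm_integral_le_of_norm_le (hG'.div_const K)
            (ae_of_all _ fun x => norm_sub_cutoff_mul_le hK (G x))
      _ ≤ C' / K := by
          rw [integral_div]; gcongr
  -- Weak convergence handles the fixed compactly supported function `cutoff K * H₀`; uniform
  -- convergence on `[-K - 1, K + 1]` allows `H₀` to be replaced by `H n`.
  have middle : ∀ K > 0, Tendsto (fun n => ∫ x, cutoff K x * H n x ∂(μ n : Measure ℝ)) atTop
      (𝓝 (∫ x, cutoff K x * H₀ x ∂(μ₀ : Measure ℝ))) := by
    intro K hK
    have hcont : Continuous fun x => (cutoff K x : ℂ) * H₀ x :=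
      (Complex.continuous_ofReal.comp (continuous_cutoff K)).mul hH₀
    have hcs : HasCompactSupport fun x => (cutoff K x : ℂ) * H₀ x := by
      refine HasCompactSupport.intro (isCompact_Icc (a := -(K + 1)) (b := K + 1)) fun x hx => ?_
      have hx' : K + 1 ≤ |x| := by
        by_contra hcon
        exact hx (abs_le.mp (not_le.mp hcon).le)
      rw [cutoff_eq_zero hx', Complex.ofReal_zero, zero_mul]
    obtain ⟨B, hB⟩ := hcs.exists_bound_of_continuous hcont
    have hweak := (ProbabilityMeasure.tendsto_iff_forall_integral_rclike_tendsto ℂ).mp hμ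
      (BoundedContinuousFunction.ofNormedAddCommGroup _ hcont B hB)
    simp only [BoundedContinuousFunction.coe_ofNormedAddCommGroup] at hweak
    rw [Metric.tendsto_atTop] at hweak ⊢
    intro ε hε
    obtain ⟨N₁, hN₁⟩ := hweak (ε / 2) (half_pos hε)
    obtain ⟨N₂, hN₂⟩ := eventually_atTop.mp
      (Metric.tendstoUniformlyOn_iff.mp (hunif (K + 1)) (ε / 2) (half_pos hε))
    refine ⟨max N₁ N₂, fun n hn => ?_⟩
    have h1 := hN₁ n ((le_max_left _ _).trans hn)
    have h2 := hN₂ n ((le_max_right _ _).trans hn)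
    have hcm : AEStronglyMeasurable (fun x => (cutoff K x : ℂ)) (μ n : Measure ℝ) :=
      (Complex.continuous_ofReal.comp (continuous_cutoff K)).aestronglyMeasurable
    have hi1 : Integrable (fun x => (cutoff K x : ℂ) * H n x) (μ n : Measure ℝ) := by
      refine (hint n).bdd_mul (c := 1) hcm (ae_of_all _ fun x => ?_)
      rw [Complex.norm_real, Real.norm_of_nonneg (cutoff_nonneg K x)]
      exact cutoff_le_one K x
    have hi2 : Integrable (fun x => (cutoff K x : ℂ) * H₀ x) (μ n : Measure ℝ) :=
      Integrable.of_bound hcont.aestronglyMeasurable B (ae_of_all _ hB)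
    have h3 : ‖∫ x, cutoff K x * H n x ∂(μ n : Measure ℝ)
        - ∫ x, cutoff K x * H₀ x ∂(μ n : Measure ℝ)‖ ≤ ε / 2 := by
      rw [← integral_sub hi1 hi2]
      refine (norm_integral_le_of_norm_le_const (C := ε / 2) (ae_of_all _ fun x => ?_)).trans
        (by simp)
      rw [← mul_sub, norm_mul, Complex.norm_real, Real.norm_of_nonneg (cutoff_nonneg K x)]
      rcases le_or_gt (K + 1) |x| with hx | hx
      · rw [cutoff_eq_zero hx, zero_mul]; exact (half_pos hε).le
      · have := h2 x (abs_le.mp hx.le)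
        rw [dist_comm, dist_eq_norm] at this
        exact (mul_le_of_le_one_left (norm_nonneg _) (cutoff_le_one K x)).trans this.le
    rw [dist_eq_norm] at h1 ⊢
    calc _ ≤ _ := norm_sub_le_norm_sub_add_norm_sub _ (∫ x, cutoff K x * H₀ x ∂(μ n : Measure ℝ)) _
      _ < ε := by linarith
  rw [Metric.tendsto_atTop]
  intro ε hε
  have hC0 : 0 ≤ C' := le_max_of_le_right (integral_nonneg fun x => by positivity)
  set K := 4 * (C' + 1) / ε with hK
  have hK0 : 0 < K := by positivity
  have hCK : C' / K < ε / 3 := by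
    rw [hK, div_lt_iff₀ (by positivity)]; field_simp; linarith
  obtain ⟨N, hN⟩ := Metric.tendsto_atTop.mp (middle K hK0) (ε / 3) (by positivity)
  refine ⟨N, fun n hn => ?_⟩
  have h1 := tail (μ n) (H n) (hint n) (hint' n) ((hC n).trans (le_max_left _ _)) K hK0
  have h2 := tail μ₀ H₀ hint₀ hint₀' (le_max_right _ _) K hK0
  have h3 := hN n hn
  rw [dist_eq_norm] at h3 ⊢
  rw [norm_sub_rev] at h2
  calc _ = ‖(∫ x, H n x ∂(μ n : Measure ℝ) - ∫ x, cutoff K x * H n x ∂(μ n : Measure ℝ))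
        + (∫ x, cutoff K x * H n x ∂(μ n : Measure ℝ)
          - ∫ x, cutoff K x * H₀ x ∂(μ₀ : Measure ℝ))
        + (∫ x, cutoff K x * H₀ x ∂(μ₀ : Measure ℝ) - ∫ x, H₀ x ∂(μ₀ : Measure ℝ))‖ := by
        congr 1; ring
    _ ≤ _ := norm_add₃_le
    _ < ε := by linarith

/-! ### Gaussian integrals -/

/-- The final `+ 0` is the constant coefficient in the shape expected by `integral_cexp_quadratic`.
-/
theorem gaussianPDFReal_zero_smul_cexp {v : ℝ≥0} (hv : v ≠ 0) (b : ℝ) (w : ℂ) (x : ℝ) :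
    gaussianPDFReal 0 v x • Complex.exp (b / 2 * x ^ 2 + w * x)
      = ((√(2 * Real.pi * v))⁻¹ : ℝ) *
        Complex.exp (((-((v : ℝ)⁻¹ - b) / 2 : ℝ) : ℂ) * x ^ 2 + w * x + 0) := by
  rw [gaussianPDFReal, Complex.real_smul]
  push_cast
  rw [mul_assoc, ← Complex.exp_add]
  congr 2
  have : (v : ℂ) ≠ 0 := by exact_mod_cast hv
  field_simp
  ring

theorem integrable_cexp_gaussianReal {v : ℝ≥0} (hv : v ≠ 0) {b : ℝ} (hb : b < (v : ℝ)⁻¹) (w : ℂ) :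
    Integrable (fun x : ℝ => Complex.exp (b / 2 * x ^ 2 + w * x)) (gaussianReal 0 v) := by
  rw [gaussianReal_of_var_ne_zero _ hv]
  rw [integrable_withDensity_iff_integrable_smul' (measurable_gaussianPDF 0 v)
    (ae_of_all _ fun _ => gaussianPDF_lt_top)]
  simp only [toReal_gaussianPDF]
  simp only [gaussianPDFReal_zero_smul_cexp hv]
  refine Integrable.const_mul ?_ _
  refine integrable_cexp_quadratic' ?_ _ _
  rw [Complex.ofReal_re]; linarith

/-- The bound `|x| ≤ exp x + exp (-x)` absorbs the first moment into shifts of `w`, staying within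
the same family of integrands. -/
theorem norm_cexp_mul_abs_le (b : ℝ) (w : ℂ) (x : ℝ) :
    ‖Complex.exp (b / 2 * x ^ 2 + w * x)‖ * |x| ≤
      ‖Complex.exp (b / 2 * x ^ 2 + (w + 1) * x)‖ + ‖Complex.exp (b / 2 * x ^ 2 + (w - 1) * x)‖ := by
  have h1 : Complex.exp (b / 2 * x ^ 2 + (w + 1) * x)
      = Complex.exp (b / 2 * x ^ 2 + w * x) * (Real.exp x : ℝ) := by
    rw [Complex.ofReal_exp, ← Complex.exp_add]; congr 1; ring
  have h2 : Complex.exp (b / 2 * x ^ 2 + (w - 1) * x)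
      = Complex.exp (b / 2 * x ^ 2 + w * x) * (Real.exp (-x) : ℝ) := by
    rw [Complex.ofReal_exp, ← Complex.exp_add]; congr 1; push_cast; ring
  rw [h1, h2, norm_mul, norm_mul, ← mul_add, Complex.norm_real, Complex.norm_real,
    Real.norm_of_nonneg (Real.exp_pos _).le, Real.norm_of_nonneg (Real.exp_pos _).le]
  refine mul_le_mul_of_nonneg_left ?_ (norm_nonneg _)
  have e1 := Real.add_one_le_exp x
  have e2 := Real.add_one_le_exp (-x)
  have p1 := Real.exp_pos x
  have p2 := Real.exp_pos (-x)
  exact abs_le.mpr ⟨by linarith, by linarith⟩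

theorem integrable_cexp_mul_abs_gaussianReal {v : ℝ≥0} (hv : v ≠ 0) {b : ℝ} (hb : b < (v : ℝ)⁻¹)
    (w : ℂ) : Integrable (fun x : ℝ => ‖Complex.exp (b / 2 * x ^ 2 + w * x)‖ * |x|)
      (gaussianReal 0 v) := by
  refine ((integrable_cexp_gaussianReal hv hb (w + 1)).norm.add
    (integrable_cexp_gaussianReal hv hb (w - 1)).norm).mono' (by fun_prop) (ae_of_all _ fun x => ?_)
  rw [Real.norm_of_nonneg (by positivity)]
  exact norm_cexp_mul_abs_le b w x

/-- Completing the square. Only `c ≠ 0` and its independence of `w` matter: it cancels when dividing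
by the value at `w = 0`. -/
theorem exists_integral_cexp_gaussianReal {v : ℝ≥0} (hv : v ≠ 0) {b : ℝ} (hb : b < (v : ℝ)⁻¹) :
    ∃ c : ℂ, c ≠ 0 ∧ ∀ w : ℂ,
      ∫ x : ℝ, Complex.exp (b / 2 * x ^ 2 + w * x) ∂(gaussianReal 0 v)
        = c * Complex.exp (w ^ 2 / (2 * ((v : ℝ)⁻¹ - b : ℝ))) := by
  have hκ : 0 < (v : ℝ)⁻¹ - b := by linarith
  have hv0 : (0 : ℝ) < v := lt_of_le_of_ne v.2 (by exact_mod_cast hv.symm)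
  set κ := (v : ℝ)⁻¹ - b with hκdef
  have hκ' : (κ : ℂ) ≠ 0 := by exact_mod_cast hκ.ne'
  refine ⟨((√(2 * Real.pi * v))⁻¹ : ℝ) * ((Real.pi : ℂ) / -((-κ / 2 : ℝ) : ℂ)) ^ (1 / 2 : ℂ),
    ?_, fun w => ?_⟩
  · refine mul_ne_zero ?_ ?_
    · have : √(2 * Real.pi * v) ≠ 0 := by positivity
      exact_mod_cast inv_ne_zero this
    · rw [Complex.cpow_ne_zero_iff]
      left
      push_cast
      field_simp
      simpa using hκ.ne'
  · rw [integral_gaussianReal_eq_integral_smul hv]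
    simp only [gaussianPDFReal_zero_smul_cexp hv, ← hκdef]
    rw [integral_const_mul, integral_cexp_quadratic (by rw [Complex.ofReal_re]; linarith),
      ← mul_assoc]
    congr 2
    push_cast
    field_simp
    ring

/-! ### Half-normal mixtures -/

/-- For each `x` the pair `-|x|, |x|` is a rearrangement of `-x, x`, and the centred Gaussian is
symmetric. -/
theorem halfNormalMixture_half (v : ℝ≥0) :
    halfNormalMixture (1 / 2) (1 / 2) v v = gaussianReal 0 v := by
  have hneg : (gaussianReal 0 v).map (fun x => -x) = gaussianReal 0 v := by
    rw [gaussianReal_map_neg, neg_zero]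
  have two : ENNReal.ofReal (1 / 2) = 2⁻¹ := by
    rw [ENNReal.ofReal_div_of_pos two_pos]; simp
  unfold halfNormalMixture posHalfNormal negHalfNormal
  rw [show (1 : ℝ) - 1 / 2 - 1 / 2 = 0 by norm_num, ENNReal.ofReal_zero, zero_smul, add_zero,
    ← smul_add, two]
  refine Measure.ext_of_lintegral _ fun f hf => ?_
  rw [lintegral_smul_measure, lintegral_add_measure, lintegral_map hf (by fun_prop),
    lintegral_map hf (by fun_prop), ← lintegral_add_left (by fun_prop)]
  have h1 : ∀ x : ℝ, f (-|x|) + f |x| = f (-x) + f x := by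
    intro x
    rcases abs_choice x with hx | hx <;> rw [hx]
    rw [neg_neg, add_comm]
  simp only [h1]
  rw [lintegral_add_left (by fun_prop)]
  have h2 : ∫⁻ x, f (-x) ∂(gaussianReal 0 v) = ∫⁻ x, f x ∂(gaussianReal 0 v) := by
    conv_rhs => rw [← hneg, lintegral_map hf (by fun_prop)]
  rw [h2, ← two_mul, smul_eq_mul, ← mul_assoc, ENNReal.inv_mul_cancel two_ne_zero (by simp),
    one_mul]

/-! ### Measures given by weights on the configuration space -/

/-- With singletons measurable, every function on the finite space `Config n` is measurable and
integrals become finite sums. -/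
instance measurableSingletonClass_intUnits : MeasurableSingletonClass ℤˣ := by
  refine ⟨fun a => ⟨{(a : ℤ)}, measurableSet_singleton _, ?_⟩⟩
  ext x
  simp [Units.ext_iff]

/-- The measure with weights `w` on the configurations. -/
def weightedMeasure {n : ℕ} (w : Config n → ℝ) : Measure (Config n) :=
  ∑ ω : Config n, ENNReal.ofReal (w ω) • Measure.dirac ω

instance weightedMeasure_isFiniteMeasure {n : ℕ} (w : Config n → ℝ) :
    IsFiniteMeasure (weightedMeasure w) := by
  constructor
  simp only [weightedMeasure, Measure.coe_finsetSum, Finset.sum_apply, Measure.smul_apply,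
    measure_univ, smul_eq_mul, mul_one]
  exact ENNReal.sum_lt_top.mpr fun _ _ => ENNReal.ofReal_lt_top

theorem isProbabilityMeasure_weightedMeasure {n : ℕ} {w : Config n → ℝ} (h0 : ∀ ω, 0 ≤ w ω)
    (h1 : ∑ ω, w ω = 1) : IsProbabilityMeasure (weightedMeasure w) := by
  constructor
  simp only [weightedMeasure, Measure.coe_finsetSum, Finset.sum_apply, Measure.smul_apply,
    measure_univ, smul_eq_mul, mul_one]
  rw [← ENNReal.ofReal_sum_of_nonneg fun ω _ => h0 ω, h1, ENNReal.ofReal_one]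

theorem integral_weightedMeasure {n : ℕ} {w : Config n → ℝ} (h0 : ∀ ω, 0 ≤ w ω) {E : Type*}
    [NormedAddCommGroup E] [NormedSpace ℝ E] [CompleteSpace E] (f : Config n → E) :
    ∫ ω, f ω ∂(weightedMeasure w) = ∑ ω, w ω • f ω := by
  unfold weightedMeasure
  have : ∀ ω, IsFiniteMeasure (ENNReal.ofReal (w ω) • Measure.dirac ω) := fun ω =>
    Measure.smul_finite _ ENNReal.ofReal_ne_top
  rw [integral_finsetSum_measure fun ω _ => Integrable.of_finite]
  refine Finset.sum_congr rfl fun ω _ => ?_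
  rw [integral_smul_measure, integral_dirac, ENNReal.toReal_ofReal (h0 ω)]

/-! ### Magnetization -/

/-- The number of plus spins. -/
def plusCount {n : ℕ} (ω : Config n) : ℕ := (Finset.univ.filter fun i => ω i = 1).card

theorem plusCount_le {n : ℕ} (ω : Config n) : plusCount ω ≤ n := by
  have := Finset.card_filter_le (Finset.univ : Finset (Fin n)) fun i => ω i = 1
  rwa [Finset.card_univ, Fintype.card_fin] at this

/-- The magnetization, i.e. the mean of the spins. -/
def mag {n : ℕ} (ω : Config n) : ℝ := 2 * plusFraction ω - 1

theorem mag_eq {n : ℕ} (ω : Config n) : mag ω = 2 * (plusCount ω / n) - 1 := rfl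

theorem plusCount_eq_mul {n : ℕ} (hn : n ≠ 0) (ω : Config n) :
    (plusCount ω : ℝ) = n * ((1 + mag ω) / 2) := by
  have : (n : ℝ) ≠ 0 := by exact_mod_cast hn
  rw [mag_eq]; field_simp; ring

theorem mag_mem_Icc {n : ℕ} (ω : Config n) : mag ω ∈ Icc (-1 : ℝ) 1 := by
  have h1 : (plusCount ω : ℝ) / n ≤ 1 :=
    div_le_one_of_le₀ (by exact_mod_cast plusCount_le ω) (by positivity)
  have h0 : 0 ≤ (plusCount ω : ℝ) / n := by positivity
  rw [mag_eq]
  exact ⟨by linarith, by linarith⟩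

theorem prod_eq_pow_mul_pow {R : Type*} [CommMonoid R] {n : ℕ} (a b : R) (ω : Config n) :
    ∏ i, (if ω i = 1 then a else b) = a ^ plusCount ω * b ^ (n - plusCount ω) := by
  rw [Finset.prod_ite, Finset.prod_const, Finset.prod_const]
  congr 2
  have := Finset.card_filter_add_card_filter_not (s := (Finset.univ : Finset (Fin n)))
    (fun i => ω i = 1)
  simp only [Finset.card_univ, Fintype.card_fin] at this
  unfold plusCount
  omega

theorem plusCount_neg {n : ℕ} (ω : Config n) : plusCount (-ω) = n - plusCount ω := by
  have := Finset.card_filter_add_card_filter_not (s := (Finset.univ : Finset (Fin n)))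
    (fun i => ω i = 1)
  simp only [Finset.card_univ, Fintype.card_fin] at this
  have h2 : plusCount (-ω) = (Finset.univ.filter fun i => ¬ ω i = 1).card := by
    unfold plusCount
    congr 1
    ext i
    simp only [Finset.mem_filter, Finset.mem_univ, true_and, Pi.neg_apply]
    rcases Int.units_eq_one_or (ω i) with h | h <;> rw [h] <;> decide
  rw [h2]
  unfold plusCount
  omega

theorem mag_neg {n : ℕ} (hn : n ≠ 0) (ω : Config n) : mag (-ω) = -mag ω := by
  have : (n : ℝ) ≠ 0 := by exact_mod_cast hn
  rw [mag_eq, mag_eq, plusCount_neg, Nat.cast_sub (plusCount_le ω)]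
  field_simp
  ring

/-- Sums over configurations of products over sites. -/
theorem sum_prod_ite {R : Type*} [CommSemiring R] (n : ℕ) (a b : R) :
    ∑ ω : Config n, ∏ i, (if ω i = 1 then a else b) = (a + b) ^ n := by
  have h := Finset.prod_univ_sum (fun _ : Fin n => (Finset.univ : Finset ℤˣ))
    (fun _ σ => if σ = 1 then a else b)
  rw [Fintype.piFinset_univ] at h
  rw [← h]
  simp

theorem sum_pow_mul_pow {R : Type*} [CommSemiring R] (n : ℕ) (a b : R) :
    ∑ ω : Config n, a ^ plusCount ω * b ^ (n - plusCount ω) = (a + b) ^ n := by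
  simp only [← sum_prod_ite, prod_eq_pow_mul_pow]

/-! ### The tilted product measure -/

/-- The weight of `ω` when the spins are independent with mean `s`. -/
def tiltWeight (s : ℝ) {n : ℕ} (ω : Config n) : ℝ :=
  ((1 + s) / 2) ^ plusCount ω * ((1 - s) / 2) ^ (n - plusCount ω)

theorem tiltWeight_nonneg {s : ℝ} (h1 : -1 ≤ s) (h2 : s ≤ 1) {n : ℕ} (ω : Config n) :
    0 ≤ tiltWeight s ω := by
  have : 0 ≤ 1 + s := by linarith
  have : 0 ≤ 1 - s := by linarith
  unfold tiltWeight
  positivity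

theorem sum_tiltWeight (s : ℝ) (n : ℕ) : ∑ ω : Config n, tiltWeight s ω = 1 := by
  unfold tiltWeight
  rw [sum_pow_mul_pow, ← add_div]
  norm_num

/-- The log-weight is affine in the magnetization, with slope `n * halfLogOdds s`; at a critical
point this slope matches that of the energy. -/
theorem tiltWeight_eq_exp {s : ℝ} (h1 : -1 < s) (h2 : s < 1) {n : ℕ} (hn : n ≠ 0) (ω : Config n) :
    tiltWeight s ω =
      Real.exp (n * ((mag ω - s) * halfLogOdds s - spinEntropy s - Real.log 2)) := by
  have a1 : 0 < 1 + s := by linarith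
  have a2 : 0 < 1 - s := by linarith
  unfold tiltWeight
  rw [← Real.exp_log (div_pos a1 two_pos), ← Real.exp_log (div_pos a2 two_pos), ← Real.exp_nat_mul,
    ← Real.exp_nat_mul, ← Real.exp_add, Nat.cast_sub (plusCount_le ω), plusCount_eq_mul hn,
    Real.log_div a1.ne' two_ne_zero, Real.log_div a2.ne' two_ne_zero]
  congr 1
  unfold halfLogOdds spinEntropy
  ring

theorem div_pow_eq_exp {n : ℕ} (hn : n ≠ 0) (k : ℕ) :
    ((k : ℝ) / n) ^ k = Real.exp (-(n * Real.negMulLog (k / n))) := by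
  have hn' : (0 : ℝ) < n := by exact_mod_cast Nat.pos_of_ne_zero hn
  rcases Nat.eq_zero_or_pos k with rfl | hk
  · simp
  · have hk' : (0 : ℝ) < k := by exact_mod_cast hk
    rw [← Real.exp_log (div_pos hk' hn'), ← Real.exp_nat_mul, Real.exp_log (div_pos hk' hn')]
    congr 1
    unfold Real.negMulLog
    field_simp

/-- Under the product law of its own mean, `ω` has exactly the entropic weight. As total mass is at
most `1`, this bounds the number of configurations of a given magnetization without Stirling's
formula. -/
theorem tiltWeight_mag {n : ℕ} (hn : n ≠ 0) (ω : Config n) :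
    tiltWeight (mag ω) ω = Real.exp (-(n * (spinEntropy (mag ω) + Real.log 2))) := by
  have hn' : (n : ℝ) ≠ 0 := by exact_mod_cast hn
  have hk := Nat.cast_sub (R := ℝ) (plusCount_le ω)
  have e1 : (1 + mag ω) / 2 = (plusCount ω : ℝ) / n := by rw [mag_eq]; ring
  have e2 : (1 - mag ω) / 2 = ((n - plusCount ω : ℕ) : ℝ) / n := by
    rw [mag_eq, hk]; field_simp; ring
  have e3 : spinEntropy (mag ω) + Real.log 2 = Real.negMulLog ((plusCount ω : ℝ) / n)
      + Real.negMulLog (((n - plusCount ω : ℕ) : ℝ) / n) := by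
    rw [spinEntropy_eq_negMulLog, show 1 + mag ω = 2 * ((plusCount ω : ℝ) / n) by rw [← e1]; ring,
      show 1 - mag ω = 2 * (((n - plusCount ω : ℕ) : ℝ) / n) by rw [← e2]; ring,
      Real.negMulLog_mul, Real.negMulLog_mul]
    have : ((n - plusCount ω : ℕ) : ℝ) / n = 1 - (plusCount ω : ℝ) / n := by rw [hk]; field_simp
    rw [this, show Real.negMulLog 2 = -(2 * Real.log 2) by unfold Real.negMulLog; ring]
    ring
  unfold tiltWeight
  rw [e1, e2, div_pow_eq_exp hn, div_pow_eq_exp hn, ← Real.exp_add, e3]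
  congr 1
  ring

theorem tiltWeight_congr (s : ℝ) {n : ℕ} {ω ω' : Config n} (h : plusCount ω = plusCount ω') :
    tiltWeight s ω = tiltWeight s ω' := by unfold tiltWeight; rw [h]

theorem mag_congr {n : ℕ} {ω ω' : Config n} (h : plusCount ω = plusCount ω') :
    mag ω = mag ω' := by rw [mag_eq, mag_eq, h]

/-- A crude bound for sums over configurations of functions of the magnetization. -/
theorem sum_exp_le {n : ℕ} (hn : n ≠ 0) (S : Finset (Config n)) (F : ℝ → ℝ) {B : ℝ}
    (hB : ∀ ω ∈ S, F (mag ω) + spinEntropy (mag ω) ≤ B) :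
    ∑ ω ∈ S, Real.exp (n * F (mag ω)) ≤ (n + 1) * (2 ^ n * Real.exp (n * B)) := by
  have hfib := Finset.sum_fiberwise_of_maps_to (s := S) (t := Finset.range (n + 1))
    (g := plusCount) (fun ω _ => Finset.mem_range.mpr (Nat.lt_succ_of_le (plusCount_le ω)))
    (fun ω => Real.exp (n * F (mag ω)))
  rw [← hfib]
  have : ∀ k ∈ Finset.range (n + 1), ∑ ω ∈ S with plusCount ω = k, Real.exp (n * F (mag ω))
      ≤ 2 ^ n * Real.exp (n * B) := by
    intro k _
    rcases (S.filter fun ω => plusCount ω = k).eq_empty_or_nonempty with he | ⟨ω₀, h₀⟩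
    · rw [he, Finset.sum_empty]; positivity
    obtain ⟨h₀S, h₀k⟩ := Finset.mem_filter.mp h₀
    -- On a layer of constant `plusCount`, the summand is a fixed multiple of the product weight
    -- tuned to that layer, whose total mass is at most `1`.
    have h1 : ∀ ω ∈ S.filter fun ω => plusCount ω = k, Real.exp (n * F (mag ω))
        = tiltWeight (mag ω₀) ω * (2 ^ n * Real.exp (n * (F (mag ω₀) + spinEntropy (mag ω₀)))) := by
      intro ω hω
      have hk : plusCount ω = plusCount ω₀ := (Finset.mem_filter.mp hω).2.trans h₀k.symm
      rw [tiltWeight_congr _ hk, tiltWeight_mag hn, mag_congr hk,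
        ← Real.exp_log (pow_pos (two_pos (α := ℝ)) n), Real.log_pow, ← Real.exp_add, ← Real.exp_add]
      congr 1
      ring
    rw [Finset.sum_congr rfl h1, ← Finset.sum_mul]
    have hm := mag_mem_Icc ω₀
    have h2 : ∑ ω ∈ S.filter fun ω => plusCount ω = k, tiltWeight (mag ω₀) ω ≤ 1 := by
      rw [← sum_tiltWeight (mag ω₀) n]
      exact Finset.sum_le_sum_of_subset_of_nonneg (Finset.subset_univ _)
        fun ω _ _ => tiltWeight_nonneg hm.1 hm.2 ω
    refine (mul_le_of_le_one_left (by positivity) h2).trans ?_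
    have := hB ω₀ h₀S
    gcongr
  refine (Finset.sum_le_sum this).trans ?_
  simp

/-- The centred generating function of a spin with mean `s`. -/
def siteGen (s : ℝ) (z : ℂ) : ℂ :=
  (1 + s) / 2 * Complex.exp (z * (1 - s)) + (1 - s) / 2 * Complex.exp (-(z * (1 + s)))

theorem sum_tiltWeight_mul_cexp (s : ℝ) (n : ℕ) (z : ℂ) :
    ∑ ω : Config n, (tiltWeight s ω : ℂ) * Complex.exp (z * (n * (mag ω - s))) =
      siteGen s z ^ n := by
  unfold siteGen
  rw [← sum_pow_mul_pow]
  refine Finset.sum_congr rfl fun ω _ => ?_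
  rcases Nat.eq_zero_or_pos n with rfl | hn
  · have : plusCount ω = 0 := Nat.le_zero.mp (plusCount_le ω)
    simp [tiltWeight, this]
  rw [mul_pow, mul_pow, ← Complex.exp_nat_mul, ← Complex.exp_nat_mul]
  have hk : (plusCount ω : ℂ) = n * ((1 + mag ω) / 2) := by
    exact_mod_cast congrArg (fun x : ℝ => (x : ℂ)) (plusCount_eq_mul hn.ne' ω)
  rw [show ∀ a b c d : ℂ, a * b * (c * d) = a * c * (b * d) from fun a b c d => by ring,
    ← Complex.exp_add, Nat.cast_sub (plusCount_le ω), hk]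
  unfold tiltWeight
  push_cast
  congr 2
  ring

/-- Second-order Taylor expansion of both exponentials. The linear terms cancel because the spin is
centred; the arguments have norm at most `2‖z‖ ≤ 1`, whence `8 = 2 ^ 3`. -/
theorem norm_siteGen_sub_le {s : ℝ} (h1 : -1 < s) (h2 : s < 1) {z : ℂ} (hz : ‖z‖ ≤ 1 / 2) :
    ‖siteGen s z - (1 + (1 - s ^ 2) * z ^ 2 / 2)‖ ≤ 8 * ‖z‖ ^ 3 := by
  have key : ∀ x : ℂ, ‖x‖ ≤ 1 → ‖Complex.exp x - (1 + x + x ^ 2 / 2)‖ ≤ ‖x‖ ^ 3 := by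
    intro x hx
    have := Complex.exp_bound hx (n := 3) (by norm_num)
    simp only [Finset.sum_range_succ, Finset.sum_range_zero] at this
    norm_num [Nat.factorial] at this
    exact this.trans (mul_le_of_le_one_right (by positivity) (by norm_num))
  have n1 : ‖(1 - s : ℂ)‖ = 1 - s := by
    rw [← Complex.ofReal_one, ← Complex.ofReal_sub, Complex.norm_real, Real.norm_of_nonneg]
    linarith
  have n2 : ‖(1 + s : ℂ)‖ = 1 + s := by
    rw [← Complex.ofReal_one, ← Complex.ofReal_add, Complex.norm_real, Real.norm_of_nonneg]
    linarith
  have b1 : ‖z * (1 - s)‖ ≤ 2 * ‖z‖ := by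
    rw [norm_mul, n1]; nlinarith [norm_nonneg z]
  have b2 : ‖-(z * (1 + s))‖ ≤ 2 * ‖z‖ := by
    rw [norm_neg, norm_mul, n2]; nlinarith [norm_nonneg z]
  have k1 := (key _ (b1.trans (by linarith))).trans (pow_le_pow_left₀ (norm_nonneg _) b1 3)
  have k2 := (key _ (b2.trans (by linarith))).trans (pow_le_pow_left₀ (norm_nonneg _) b2 3)
  have e : siteGen s z - (1 + (1 - s ^ 2) * z ^ 2 / 2)
      = (1 + s) / 2 * (Complex.exp (z * (1 - s)) - (1 + z * (1 - s) + (z * (1 - s)) ^ 2 / 2))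
      + (1 - s) / 2 * (Complex.exp (-(z * (1 + s)))
        - (1 + -(z * (1 + s)) + (-(z * (1 + s))) ^ 2 / 2)) := by
    unfold siteGen; ring
  rw [e]
  refine (norm_add_le _ _).trans ?_
  rw [norm_mul, norm_mul, norm_div, norm_div, n1, n2, Complex.norm_ofNat]
  have c1 : 0 < (1 + s) / 2 := by linarith
  have c2 : 0 < (1 - s) / 2 := by linarith
  nlinarith [mul_le_mul_of_nonneg_left k1 c1.le, mul_le_mul_of_nonneg_left k2 c2.le]

/-! ### Fluctuations of the magnetization under the tilted product measure -/

/-- The rescaled magnetization. -/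
def fluct (s : ℝ) {n : ℕ} (ω : Config n) : ℝ := √n * (mag ω - s)

theorem abs_fluct_le {s : ℝ} (h1 : -1 < s) (h2 : s < 1) {n : ℕ} (ω : Config n) :
    |fluct s ω| ≤ 2 * √n := by
  have := mag_mem_Icc ω
  unfold fluct
  rw [abs_mul, abs_of_nonneg (Real.sqrt_nonneg _), mul_comm]
  refine mul_le_mul_of_nonneg_right ?_ (Real.sqrt_nonneg _)
  exact abs_le.mpr ⟨by linarith [this.1], by linarith [this.2]⟩

theorem sum_tiltWeight_mul_cexp_fluct (s : ℝ) {n : ℕ} (hn : n ≠ 0) (z : ℂ) :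
    ∑ ω : Config n, (tiltWeight s ω : ℂ) * Complex.exp (z * fluct s ω) =
      siteGen s (z / √n) ^ n := by
  rw [← sum_tiltWeight_mul_cexp]
  refine Finset.sum_congr rfl fun ω _ => ?_
  congr 2
  have hn' : (√n : ℂ) ≠ 0 := by
    have : √(n : ℝ) ≠ 0 := by
      rw [Real.sqrt_ne_zero']; exact_mod_cast Nat.pos_of_ne_zero hn
    exact_mod_cast this
  have hs : (n : ℂ) = √n * √n := by
    rw [← Complex.ofReal_mul, Real.mul_self_sqrt (Nat.cast_nonneg n)]; simp
  unfold fluct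
  rw [hs]
  push_cast
  field_simp

/-- The Taylor error at `z / √n` is `O(n^(-3/2)) = o(1 / n)`, so it does not affect the limit of the
`n`-th power. -/
theorem tendsto_siteGen_pow {s : ℝ} (h1 : -1 < s) (h2 : s < 1) (z : ℂ) :
    Tendsto (fun n : ℕ => siteGen s (z / √n) ^ n) atTop
      (𝓝 (Complex.exp ((1 - s ^ 2) * z ^ 2 / 2))) := by
  apply Complex.tendsto_pow_exp_of_isLittleO_sub_add_div
  have hO : (fun n : ℕ => siteGen s (z / √n) - (1 + (1 - s ^ 2) * z ^ 2 / 2 / n)) =O[atTop]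
      fun n : ℕ => (1 / n : ℝ) * (1 / √n) := by
    refine Asymptotics.IsBigO.of_bound (8 * ‖z‖ ^ 3) ?_
    have hsq : Tendsto (fun n : ℕ => √(n : ℝ)) atTop atTop :=
      Real.tendsto_sqrt_atTop.comp tendsto_natCast_atTop_atTop
    filter_upwards [hsq.eventually_ge_atTop (2 * ‖z‖ + 1)] with n hn
    have hz0 := norm_nonneg z
    have hpos : 0 < √(n : ℝ) := by linarith
    have hs : (√n : ℂ) ^ 2 = n := by
      rw [← Complex.ofReal_pow, Real.sq_sqrt (Nat.cast_nonneg n)]; simp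
    have hs' : (√n : ℝ) ^ 2 = n := Real.sq_sqrt (Nat.cast_nonneg n)
    have hz : ‖z / √n‖ = ‖z‖ / √n := by
      rw [norm_div, Complex.norm_real, Real.norm_of_nonneg hpos.le]
    have := norm_siteGen_sub_le h1 h2 (z := z / √n)
      (by rw [hz, div_le_iff₀ hpos]; linarith)
    rw [hz] at this
    convert this using 1
    · congr 3
      rw [div_pow, hs]; ring
    · have hn' : (1 / n : ℝ) = 1 / √n ^ 2 := by rw [hs']
      rw [Real.norm_of_nonneg (by positivity), hn']
      field_simp
  have ho : (fun n : ℕ => (1 / n : ℝ) * (1 / √n)) =o[atTop] fun n : ℕ => (1 / n : ℝ) * 1 := by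
    refine (Asymptotics.isBigO_refl _ _).mul_isLittleO ?_
    rw [Asymptotics.isLittleO_one_iff]
    have hsq : Tendsto (fun n : ℕ => √(n : ℝ)) atTop atTop :=
      Real.tendsto_sqrt_atTop.comp tendsto_natCast_atTop_atTop
    exact tendsto_const_nhds.div_atTop hsq
  have := hO.trans_isLittleO ho
  rw [← Asymptotics.isLittleO_norm_right] at this ⊢
  simpa using this

/-- The law of the rescaled magnetization under the tilted product measure. -/
def tiltLaw (s : Icc (-1 : ℝ) 1) (n : ℕ) : ProbabilityMeasure ℝ :=
  ⟨(weightedMeasure (n := n) (tiltWeight s)).map (fluct s),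
    haveI := isProbabilityMeasure_weightedMeasure (n := n)
      (fun ω => tiltWeight_nonneg s.2.1 s.2.2 ω) (sum_tiltWeight s n)
    Measure.isProbabilityMeasure_map (measurable_of_finite _).aemeasurable⟩

theorem integral_tiltLaw (s : Icc (-1 : ℝ) 1) (n : ℕ) {E : Type*} [NormedAddCommGroup E]
    [NormedSpace ℝ E] [CompleteSpace E] {f : ℝ → E} (hf : StronglyMeasurable f) :
    ∫ x, f x ∂(tiltLaw s n : Measure ℝ) =
      ∑ ω : Config n, tiltWeight (s : ℝ) ω • f (fluct (s : ℝ) ω) := by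
  rw [← integral_weightedMeasure fun ω => tiltWeight_nonneg s.2.1 s.2.2 ω]
  exact integral_map (measurable_of_finite _).aemeasurable hf.aestronglyMeasurable

theorem integrable_tiltLaw (s : Icc (-1 : ℝ) 1) (n : ℕ) {E : Type*} [NormedAddCommGroup E]
    {f : ℝ → E} (hf : StronglyMeasurable f) : Integrable f (tiltLaw s n : Measure ℝ) := by
  refine (integrable_map_measure hf.aestronglyMeasurable
    (measurable_of_finite _).aemeasurable).mpr ?_
  exact Integrable.of_finite

theorem tendsto_tiltLaw {s : Icc (-1 : ℝ) 1} (h1 : -1 < (s : ℝ)) (h2 : (s : ℝ) < 1) {v : ℝ≥0}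
    (hv : (v : ℝ) = 1 - (s : ℝ) ^ 2) :
    Tendsto (tiltLaw s) atTop (𝓝 ⟨gaussianReal 0 v, inferInstance⟩) := by
  refine ProbabilityMeasure.tendsto_of_tendsto_charFun fun t => ?_
  have h := tendsto_siteGen_pow h1 h2 (t * Complex.I)
  have e : charFun (gaussianReal 0 v) t
      = Complex.exp ((1 - (s : ℝ) ^ 2) * (t * Complex.I) ^ 2 / 2) := by
    rw [charFun_gaussianReal, mul_pow, Complex.I_sq]
    congr 1
    have : (v : ℂ) = 1 - (s : ℝ) ^ 2 := by exact_mod_cast congrArg (fun x : ℝ => (x : ℂ)) hv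
    rw [show ((v : ℝ) : ℂ) = (v : ℂ) from rfl, this]
    push_cast
    ring
  rw [ProbabilityMeasure.coe_mk, e]
  refine h.congr' ?_
  filter_upwards [eventually_ne_atTop 0] with n hn
  rw [← sum_tiltWeight_mul_cexp_fluct _ hn, charFun_apply_real,
    integral_tiltLaw s n (Continuous.stronglyMeasurable (by fun_prop))]
  refine Finset.sum_congr rfl fun ω _ => ?_
  rw [Complex.real_smul]
  congr 2
  ring

/-- A Gaussian exponential is dominated by a sum of exponentials over the integers. -/
theorem exp_sq_le_sum {a x : ℝ} (ha : 0 < a) {J : ℕ} (hJ : a * |x| ≤ J) :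
    Real.exp (a * x ^ 2 / 2) ≤ Real.exp (1 / (8 * a)) *
      ∑ j ∈ Finset.Icc (-(J : ℤ)) J, Real.exp (j * x - j ^ 2 / (2 * a)) := by
  -- The nearest integer nearly maximizes `j x - j² / (2a)`: the loss `(a x - j)² / (2a)` is at most
  -- `1 / (8a)`.
  set j := round (a * x) with hj
  have hd := abs_sub_round (a * x)
  rw [← hj] at hd
  have hjJ : j ∈ Finset.Icc (-(J : ℤ)) J := by
    have h1 : |a * x| ≤ J := by rwa [abs_mul, abs_of_pos ha]
    obtain ⟨h2, h3⟩ := abs_le.mp hd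
    obtain ⟨h4, h5⟩ := abs_le.mp h1
    rw [Finset.mem_Icc]
    constructor
    · have : (-(J : ℤ) : ℝ) - 1 < j := by push_cast; linarith
      have : -(J : ℤ) - 1 < j := by exact_mod_cast this
      omega
    · have : (j : ℝ) < (J : ℤ) + 1 := by push_cast; linarith
      have : j < (J : ℤ) + 1 := by exact_mod_cast this
      omega
  refine le_trans ?_ (mul_le_mul_of_nonneg_left
    (Finset.single_le_sum (f := fun j : ℤ => Real.exp (j * x - j ^ 2 / (2 * a)))
      (fun _ _ => (Real.exp_pos _).le) hjJ) (Real.exp_pos _).le)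
  rw [← Real.exp_add, Real.exp_le_exp]
  have h2 : (a * x - j) ^ 2 ≤ (1 / 2) ^ 2 := sq_le_sq' (by linarith [(abs_le.mp hd).1]) (abs_le.mp hd).2
  have : a * x ^ 2 / 2 - (j * x - j ^ 2 / (2 * a)) = (a * x - j) ^ 2 / (2 * a) := by
    field_simp; ring
  have h3 : (a * x - j) ^ 2 / (2 * a) ≤ (1 / 2) ^ 2 / (2 * a) := by gcongr
  have h4 : (1 / 2 : ℝ) ^ 2 / (2 * a) = 1 / (8 * a) := by field_simp; norm_num
  linarith

theorem summable_exp_neg_mul_int_sq {c : ℝ} (hc : 0 < c) :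
    Summable fun j : ℤ => Real.exp (-(c * (j : ℝ) ^ 2)) := by
  have hg : Summable fun k : ℕ => Real.exp (-c) ^ k :=
    summable_geometric_of_lt_one (Real.exp_pos _).le (by rw [Real.exp_lt_one_iff]; linarith)
  have hN : Summable fun k : ℕ => Real.exp (-(c * (k : ℝ) ^ 2)) := by
    refine Summable.of_nonneg_of_le (fun _ => (Real.exp_pos _).le) (fun k => ?_) hg
    rw [← Real.exp_nat_mul, Real.exp_le_exp]
    have : (k : ℝ) ≤ (k : ℝ) ^ 2 := by
      exact_mod_cast Nat.le_self_pow two_ne_zero k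
    nlinarith
  refine Summable.of_nat_of_neg ?_ ?_
  · simpa using hN
  · simpa using hN

/-- Sub-Gaussian bound near the origin for the rescaled magnetization. -/
theorem exists_sum_tiltWeight_mul_exp_le {s : ℝ} (h1 : -1 < s) (h2 : s < 1) {v' : ℝ}
    (hv' : 1 - s ^ 2 < v') : ∃ δ > 0, ∀ (n : ℕ) (t : ℝ), |t| ≤ δ * √n →
      ∑ ω : Config n, tiltWeight s ω * Real.exp (t * fluct s ω) ≤ Real.exp (v' * t ^ 2 / 2) := by
  have hv : 0 < v' - (1 - s ^ 2) := by linarith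
  -- `1 / 2` is the range of `norm_siteGen_sub_le`; the other bound lets the excess variance `v' -
  -- (1 - s²)` absorb the cubic error.
  refine ⟨min (1 / 2) ((v' - (1 - s ^ 2)) / 16), by positivity, fun n t ht => ?_⟩
  rcases eq_or_ne n 0 with rfl | hn
  · have ht0 : t = 0 := by simpa using ht
    simp only [ht0, zero_mul, Real.exp_zero, mul_one, sum_tiltWeight]
    simp
  have hpos : 0 < √(n : ℝ) := Real.sqrt_pos.mpr (by exact_mod_cast Nat.pos_of_ne_zero hn)
  set τ := t / √(n : ℝ) with hτ
  have hτ1 : |τ| ≤ min (1 / 2) ((v' - (1 - s ^ 2)) / 16) := by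
    rw [hτ, abs_div, abs_of_pos hpos, div_le_iff₀ hpos]; exact ht
  have hgen := sum_tiltWeight_mul_cexp_fluct s hn (t : ℂ)
  have hτc : (t : ℂ) / √n = (τ : ℂ) := by rw [hτ]; push_cast; rfl
  rw [hτc] at hgen
  set g : ℝ := (1 + s) / 2 * Real.exp (τ * (1 - s)) + (1 - s) / 2 * Real.exp (-(τ * (1 + s)))
    with hg
  have hgc : siteGen s (τ : ℂ) = (g : ℂ) := by
    rw [hg]; unfold siteGen; push_cast; rfl
  have hsum : ∑ ω : Config n, tiltWeight s ω * Real.exp (t * fluct s ω) = g ^ n := by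
    rw [hgc] at hgen
    exact_mod_cast hgen
  have g0 : 0 ≤ g := by
    have : 0 < 1 + s := by linarith
    have : 0 < 1 - s := by linarith
    positivity
  have hb := norm_siteGen_sub_le h1 h2 (z := (τ : ℂ))
    (by rw [Complex.norm_real]; exact hτ1.trans (min_le_left _ _))
  rw [hgc, Complex.norm_real] at hb
  have hb' : |g - (1 + (1 - s ^ 2) * τ ^ 2 / 2)| ≤ 8 * |τ| ^ 3 := by
    rw [← Real.norm_eq_abs, ← Real.norm_eq_abs, ← Complex.norm_real]
    exact_mod_cast hb
  have hg1 : g ≤ 1 + v' * τ ^ 2 / 2 := by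
    have h3 : |τ| ^ 3 ≤ (v' - (1 - s ^ 2)) / 16 * τ ^ 2 := by
      rw [← sq_abs τ, pow_succ, mul_comm]
      exact mul_le_mul_of_nonneg_right (hτ1.trans (min_le_right _ _)) (by positivity)
    have := (abs_le.mp hb').2
    linarith
  rw [hsum]
  calc g ^ n ≤ Real.exp (v' * τ ^ 2 / 2) ^ n := by
        refine pow_le_pow_left₀ g0 (hg1.trans ?_) n
        have := Real.add_one_le_exp (v' * τ ^ 2 / 2)
        linarith
    _ = Real.exp (v' * t ^ 2 / 2) := by
        rw [← Real.exp_nat_mul, hτ, div_pow, Real.sq_sqrt (Nat.cast_nonneg n)]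
        congr 1
        have : (n : ℝ) ≠ 0 := by exact_mod_cast hn
        field_simp

/-- Gaussian exponential moments of the rescaled magnetization, restricted to magnetizations near
`s`, are bounded. -/
theorem exists_sum_tiltWeight_mul_exp_sq_le {s : ℝ} (h1 : -1 < s) (h2 : s < 1) {a : ℝ}
    (ha : 0 < a) (ha' : a < 1 / (1 - s ^ 2)) :
    ∃ η > 0, ∃ C, ∀ n : ℕ, ∑ ω : Config n with |fluct s ω| ≤ η * √n,
      tiltWeight s ω * Real.exp (a * fluct s ω ^ 2 / 2) ≤ C := by
  have hs : 0 < 1 - s ^ 2 := by nlinarith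
  have hsa : 1 - s ^ 2 < 1 / a := by
    rw [lt_div_iff₀ ha]; rwa [lt_div_iff₀ hs, mul_comm] at ha'
  obtain ⟨v', hv1, hv2⟩ := exists_between hsa
  obtain ⟨δ, hδ, hmgf⟩ := exists_sum_tiltWeight_mul_exp_le h1 h2 hv1
  -- The `j`-th exponential contributes `exp (v' j² / 2 - j² / (2a)) = exp (-c j²)`, summable over
  -- the integers.
  set c := (1 / a - v') / 2 with hc
  have hc0 : 0 < c := by rw [hc]; linarith
  set T := ∑' j : ℤ, Real.exp (-(c * (j : ℝ) ^ 2))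
  have hw : ∀ {n : ℕ} (ω : Config n), 0 ≤ tiltWeight s ω := fun ω =>
    tiltWeight_nonneg h1.le h2.le ω
  -- This radius gives `a |x| ≤ δ √n / 2`, which is below `⌊δ √n⌋` once `δ √n ≥ 2`. The second entry
  -- of the maximum covers the remaining small `n`, where `|fluct| ≤ 2 √n`.
  refine ⟨δ / (2 * a), by positivity,
    max (Real.exp (1 / (8 * a)) * T) (Real.exp (a * (2 * (2 / δ)) ^ 2 / 2)), fun n => ?_⟩
  rcases le_or_gt (2 / δ) (√(n : ℝ)) with hn | hn
  · refine le_max_of_le_left ?_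
    set J := ⌊δ * √(n : ℝ)⌋₊ with hJ
    have hn2 : 2 ≤ δ * √n := by rw [div_le_iff₀ hδ] at hn; linarith
    have hJ1 : (J : ℝ) ≤ δ * √n := Nat.floor_le (by positivity)
    have hJ2 : δ * √n < J + 1 := Nat.lt_floor_add_one _
    calc _ ≤ ∑ ω : Config n with |fluct s ω| ≤ δ / (2 * a) * √n, tiltWeight s ω *
          (Real.exp (1 / (8 * a)) * ∑ j ∈ Finset.Icc (-(J : ℤ)) J,
            Real.exp (j * fluct s ω - j ^ 2 / (2 * a))) := by
          refine Finset.sum_le_sum fun ω hω => mul_le_mul_of_nonneg_left ?_ (hw ω)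
          refine exp_sq_le_sum ha ?_
          have h3 := mul_le_mul_of_nonneg_left (Finset.mem_filter.mp hω).2 ha.le
          have h4 : a * (δ / (2 * a) * √n) = δ * √n / 2 := by field_simp
          linarith
      _ ≤ ∑ ω : Config n, tiltWeight s ω *
          (Real.exp (1 / (8 * a)) * ∑ j ∈ Finset.Icc (-(J : ℤ)) J,
            Real.exp (j * fluct s ω - j ^ 2 / (2 * a))) := by
          refine Finset.sum_le_sum_of_subset_of_nonneg (Finset.subset_univ _) fun ω _ _ => ?_
          have := hw ω
          positivity
      _ = Real.exp (1 / (8 * a)) * ∑ j ∈ Finset.Icc (-(J : ℤ)) J,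
          Real.exp (-(j ^ 2 / (2 * a))) *
            ∑ ω : Config n, tiltWeight s ω * Real.exp (j * fluct s ω) := by
          simp only [Finset.mul_sum]
          rw [Finset.sum_comm]
          refine Finset.sum_congr rfl fun j _ => Finset.sum_congr rfl fun ω _ => ?_
          rw [sub_eq_add_neg, Real.exp_add]; ring
      _ ≤ Real.exp (1 / (8 * a)) * ∑ j ∈ Finset.Icc (-(J : ℤ)) J,
          Real.exp (-(c * (j : ℝ) ^ 2)) := by
          refine mul_le_mul_of_nonneg_left (Finset.sum_le_sum fun j hj => ?_) (Real.exp_pos _).le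
          have hj' : |(j : ℝ)| ≤ δ * √n := by
            refine le_trans ?_ hJ1
            rw [Finset.mem_Icc] at hj
            rw [abs_le]
            exact ⟨by exact_mod_cast hj.1, by exact_mod_cast hj.2⟩
          refine (mul_le_mul_of_nonneg_left (hmgf n j hj') (Real.exp_pos _).le).trans ?_
          rw [← Real.exp_add, Real.exp_le_exp, hc]
          apply le_of_eq
          field_simp
          ring
      _ ≤ _ := by
          refine mul_le_mul_of_nonneg_left ?_ (Real.exp_pos _).le
          exact (summable_exp_neg_mul_int_sq hc0).sum_le_tsum _ fun _ _ => (Real.exp_pos _).le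
  · refine le_max_of_le_right ?_
    calc _ ≤ ∑ ω : Config n with |fluct s ω| ≤ δ / (2 * a) * √n, tiltWeight s ω *
          Real.exp (a * (2 * (2 / δ)) ^ 2 / 2) := by
          refine Finset.sum_le_sum fun ω _ => mul_le_mul_of_nonneg_left ?_ (hw ω)
          rw [Real.exp_le_exp, ← sq_abs]
          have := abs_fluct_le h1 h2 ω
          gcongr
          linarith
      _ ≤ ∑ ω : Config n, tiltWeight s ω * Real.exp (a * (2 * (2 / δ)) ^ 2 / 2) := by
          refine Finset.sum_le_sum_of_subset_of_nonneg (Finset.subset_univ _) fun ω _ _ => ?_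
          have := hw ω
          positivity
      _ = _ := by rw [← Finset.sum_mul, sum_tiltWeight, one_mul]

/-! ### Laplace asymptotics of exponential sums over configurations -/

/-- The quadratic remainder of the energy at the magnetization `s`. -/
def energyRemainder (β h s y : ℝ) : ℝ := (12 * β * s ^ 2 + 2 * h) / 2 + 4 * β * s * y + β * y ^ 2

theorem continuous_energyRemainder (β h s : ℝ) : Continuous (energyRemainder β h s) := by
  unfold energyRemainder; fun_prop

theorem sqrt_cast_ne_zero {n : ℕ} (hn : n ≠ 0) : √(n : ℝ) ≠ 0 := by
  rw [Real.sqrt_ne_zero']; exact_mod_cast Nat.pos_of_ne_zero hn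

theorem fluct_div_sqrt {s : ℝ} {n : ℕ} (hn : n ≠ 0) (ω : Config n) :
    fluct s ω * (√n)⁻¹ = mag ω - s := by
  have := sqrt_cast_ne_zero hn
  unfold fluct
  field_simp

/-- The exponential growth of sums of Gibbs weights. -/
def growth (β h s : ℝ) (n : ℕ) : ℝ := 2 ^ n * Real.exp (n * rate β h s)

theorem growth_pos (β h s : ℝ) (n : ℕ) : 0 < growth β h s n := by unfold growth; positivity

/-- The energy is a quartic, so its expansion at `s` is exact. By `hcrit` its linear term is the one
already present in `tiltWeight`, leaving only terms of order two and higher. -/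
theorem exp_energy_eq {β h s : ℝ} (hs0 : 0 < s) (hs1 : s < 1)
    (hcrit : 4 * β * s ^ 3 + 2 * h * s = halfLogOdds s) {n : ℕ} (hn : n ≠ 0) (ω : Config n) :
    Real.exp (n * (β * mag ω ^ 4 + h * mag ω ^ 2)) = growth β h s n * (tiltWeight s ω *
      Real.exp (fluct s ω ^ 2 * energyRemainder β h s (fluct s ω * (√n)⁻¹))) := by
  rw [tiltWeight_eq_exp (by linarith) hs1 hn, ← hcrit, fluct_div_sqrt hn, growth,
    ← Real.exp_log (pow_pos (two_pos (α := ℝ)) n), Real.log_pow, ← Real.exp_add, ← Real.exp_add,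
    ← Real.exp_add]
  congr 1
  unfold fluct rate energyRemainder
  rw [mul_pow, Real.sq_sqrt (Nat.cast_nonneg n)]
  ring

/-- The sum of the Gibbs weights times `exp (z √n (u (mag ω) - c))`. -/
def gibbsSum (β h : ℝ) (u : ℝ → ℝ) (c : ℝ) (n : ℕ) (z : ℂ) : ℂ :=
  ∑ ω : Config n, (Real.exp (n * (β * mag ω ^ 4 + h * mag ω ^ 2)) : ℂ) *
    Complex.exp (z * (√n * (u (mag ω) - c) : ℝ))

theorem tendsto_inv_sqrt_cast : Tendsto (fun n : ℕ => (√(n : ℝ))⁻¹) atTop (𝓝 0) :=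
  tendsto_inv_atTop_zero.comp (Real.tendsto_sqrt_atTop.comp tendsto_natCast_atTop_atTop)

/-- Currying makes the parameter dependence continuous for the compact-open topology. -/
theorem tendstoUniformlyOn_of_continuous {Φ : ℝ × ℝ → ℂ} (hΦ : Continuous Φ) (K : ℝ) :
    TendstoUniformlyOn (fun (n : ℕ) x => Φ ((√(n : ℝ))⁻¹, x)) (fun x => Φ (0, x)) atTop
      (Icc (-K) K) := by
  have h1 : Tendsto (fun n : ℕ => (ContinuousMap.mk Φ hΦ).curry (√(n : ℝ))⁻¹) atTop
      (𝓝 ((ContinuousMap.mk Φ hΦ).curry 0)) :=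
    ((ContinuousMap.mk Φ hΦ).curry.continuous.tendsto 0).comp tendsto_inv_sqrt_cast
  exact ContinuousMap.tendsto_iff_forall_isCompact_tendstoUniformlyOn.mp h1 _ isCompact_Icc

/-- The integrand describing the contribution of magnetizations near `s`. -/
def nearIntegrand (r q : ℝ → ℝ) (η : ℝ) (z : ℂ) (n : ℕ) (x : ℝ) : ℂ :=
  {x : ℝ | |x| ≤ η * √n}.indicator
    (fun x => Complex.exp ((x ^ 2 * r (x * (√n)⁻¹) : ℝ) + z * (x * q (x * (√n)⁻¹) : ℝ))) x

theorem stronglyMeasurable_nearIntegrand {r q : ℝ → ℝ} (hr : Continuous r) (hq : Continuous q)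
    (η : ℝ) (z : ℂ) (n : ℕ) : StronglyMeasurable (nearIntegrand r q η z n) := by
  refine StronglyMeasurable.indicator (Continuous.stronglyMeasurable ?_)
    (measurableSet_le (by fun_prop) (by fun_prop))
  fun_prop

theorem tendstoUniformlyOn_nearIntegrand {r q : ℝ → ℝ} (hr : Continuous r) (hq : Continuous q)
    {η : ℝ} (hη : 0 < η) (z : ℂ) (K : ℝ) :
    TendstoUniformlyOn (nearIntegrand r q η z)
      (fun x : ℝ => Complex.exp ((2 * r 0 : ℝ) / 2 * x ^ 2 + z * q 0 * x)) atTop (Icc (-K) K) := by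
  have h := tendstoUniformlyOn_of_continuous (Φ := fun p : ℝ × ℝ =>
    Complex.exp ((p.2 ^ 2 * r (p.2 * p.1) : ℝ) + z * (p.2 * q (p.2 * p.1) : ℝ))) (by fun_prop) K
  have h2 : TendstoUniformlyOn (nearIntegrand r q η z)
      (fun x : ℝ => Complex.exp ((x ^ 2 * r (x * 0) : ℝ) + z * (x * q (x * 0) : ℝ))) atTop
      (Icc (-K) K) := by
    refine h.congr ?_
    have hsq : Tendsto (fun n : ℕ => η * √(n : ℝ)) atTop atTop :=
      (Real.tendsto_sqrt_atTop.comp tendsto_natCast_atTop_atTop).const_mul_atTop hη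
    filter_upwards [hsq.eventually_ge_atTop K] with n hn x hx
    have : x ∈ {x : ℝ | |x| ≤ η * √n} := (abs_le.mpr hx).trans hn
    unfold nearIntegrand
    rw [indicator_of_mem this]
  refine h2.congr_right fun x _ => ?_
  simp only [mul_zero]
  congr 1
  push_cast
  ring

/-- With `|x| ≤ exp |x|`, every factor besides the quadratic one is at most `exp ((‖z‖ Q + 1) |x|)`;
the gap `a - a'` pays for it by completing the square. -/
theorem norm_nearIntegrand_mul_abs_le {r q : ℝ → ℝ} {η a a' Q : ℝ} (haa : a' < a)
    (hr : ∀ y, |y| ≤ η → r y ≤ a' / 2) (hq : ∀ y, |y| ≤ η → |q y| ≤ Q) (z : ℂ) {n : ℕ}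
    (hn : n ≠ 0) (x : ℝ) :
    ‖nearIntegrand r q η z n x‖ * |x| ≤ {x : ℝ | |x| ≤ η * √n}.indicator (fun x =>
      Real.exp ((‖z‖ * Q + 1) ^ 2 / (2 * (a - a'))) * Real.exp (a * x ^ 2 / 2)) x := by
  unfold nearIntegrand
  by_cases hx : x ∈ {x : ℝ | |x| ≤ η * √n}
  · rw [indicator_of_mem hx, indicator_of_mem hx, Complex.norm_exp, ← Real.exp_add]
    have hpos : 0 < √(n : ℝ) := lt_of_le_of_ne (Real.sqrt_nonneg _) (sqrt_cast_ne_zero hn).symm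
    have hy : |x * (√n)⁻¹| ≤ η := by
      rw [abs_mul, abs_of_pos (inv_pos.mpr hpos), ← div_eq_mul_inv, div_le_iff₀ hpos]; exact hx
    have h1 := hr _ hy
    have h2 := hq _ hy
    have hxe : |x| ≤ Real.exp |x| := by linarith [Real.add_one_le_exp |x|]
    refine (mul_le_mul_of_nonneg_left hxe (Real.exp_pos _).le).trans ?_
    rw [← Real.exp_add, Real.exp_le_exp, Complex.add_re, Complex.ofReal_re, Complex.re_mul_ofReal]
    have h3 : z.re * (x * q (x * (√n)⁻¹)) ≤ ‖z‖ * (|x| * Q) := by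
      refine (le_abs_self _).trans ?_
      rw [abs_mul, abs_mul]
      gcongr
      exact Complex.abs_re_le_norm z
    have h4 : x ^ 2 * r (x * (√n)⁻¹) ≤ x ^ 2 * (a' / 2) := by gcongr
    have h5 : (‖z‖ * Q + 1) * |x| ≤ (‖z‖ * Q + 1) ^ 2 / (2 * (a - a')) + (a - a') * x ^ 2 / 2 := by
      have hd : 0 < a - a' := by linarith
      rw [← sq_abs x, ← sub_nonneg]
      have : (‖z‖ * Q + 1) ^ 2 / (2 * (a - a')) + (a - a') * |x| ^ 2 / 2 - (‖z‖ * Q + 1) * |x|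
        = ((‖z‖ * Q + 1) - (a - a') * |x|) ^ 2 / (2 * (a - a')) := by
        field_simp; ring
      rw [this]
      positivity
    linarith
  · rw [indicator_of_notMem hx, indicator_of_notMem hx]; simp

/-- The contribution of the magnetizations near `s`. -/
theorem exists_tendsto_near {s : ℝ} (h1 : -1 < s) (h2 : s < 1) {r q : ℝ → ℝ} (hr : Continuous r)
    (hq : Continuous q) (hb : 2 * r 0 < 1 / (1 - s ^ 2)) {η₀ : ℝ} (hη₀ : 0 < η₀) :
    ∃ η > 0, η ≤ η₀ ∧ ∀ z : ℂ, Tendsto (fun n : ℕ => ∑ ω : Config n with |fluct s ω| ≤ η * √n,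
        (tiltWeight s ω : ℂ) * Complex.exp ((fluct s ω ^ 2 * r (fluct s ω * (√n)⁻¹) : ℝ) +
          z * (fluct s ω * q (fluct s ω * (√n)⁻¹) : ℝ))) atTop
      (𝓝 (∫ x : ℝ, Complex.exp ((2 * r 0 : ℝ) / 2 * x ^ 2 + z * q 0 * x)
        ∂(gaussianReal 0 (1 - s ^ 2).toNNReal))) := by
  have hs : 0 < 1 - s ^ 2 := by nlinarith
  -- `2 * r 0` may be negative, while the moment bound requires a positive exponent `a`.
  set b := max (2 * r 0) 0 with hbdef
  have hbv : b < 1 / (1 - s ^ 2) := max_lt hb (by positivity)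
  obtain ⟨a, ha1, ha2⟩ := exists_between hbv
  obtain ⟨a', ha'1, ha'2⟩ := exists_between ha1
  have ha0 : 0 < a := (le_max_right _ _).trans_lt ha1
  obtain ⟨η₁, hη₁, C, hC⟩ := exists_sum_tiltWeight_mul_exp_sq_le h1 h2 ha0 ha2
  have hr0 : r 0 < a' / 2 := by
    have := (le_max_left (2 * r 0) 0).trans_lt ha'1
    linarith
  obtain ⟨η₂, hη₂, hr2⟩ := Metric.eventually_nhds_iff.mp (hr.continuousAt.eventually_lt_const hr0)
  obtain ⟨Q, hQ⟩ := (isCompact_Icc (a := -η₀) (b := η₀)).exists_bound_of_continuousOn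
    hq.continuousOn
  set η := min (min η₁ (η₂ / 2)) η₀ with hη
  have hη0 : 0 < η := by positivity
  have e1 : η ≤ η₁ := (min_le_left _ _).trans (min_le_left _ _)
  have e2 : η ≤ η₂ / 2 := (min_le_left _ _).trans (min_le_right _ _)
  have e3 : η ≤ η₀ := min_le_right _ _
  refine ⟨η, hη0, e3, fun z => ?_⟩
  have hrη : ∀ y, |y| ≤ η → r y ≤ a' / 2 := fun y hy =>
    (hr2 (by rw [dist_zero_right, Real.norm_eq_abs]; linarith)).le
  have hqη : ∀ y, |y| ≤ η → |q y| ≤ Q := fun y hy => hQ y (abs_le.mp (hy.trans e3))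
  set σ : Icc (-1 : ℝ) 1 := ⟨s, h1.le, h2.le⟩ with hσ
  have hvn : (1 - s ^ 2).toNNReal ≠ 0 := by simpa using hs
  have hvc : ((1 - s ^ 2).toNNReal : ℝ) = 1 - s ^ 2 := Real.coe_toNNReal _ hs.le
  have hbv' : 2 * r 0 < (((1 - s ^ 2).toNNReal : ℝ))⁻¹ := by rw [hvc, ← one_div]; exact hb
  -- The index is shifted by one because the domination by a Gaussian exponential requires `n ≠ 0`.
  have hconv := (tendsto_tiltLaw (s := σ) h1 h2 hvc).comp (tendsto_add_atTop_nat 1)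
  have hmeas := stronglyMeasurable_nearIntegrand hr hq η z
  have hmeas' : ∀ n, StronglyMeasurable fun x => ‖nearIntegrand r q η z n x‖ * |x| := fun n =>
    (hmeas n).norm.mul continuous_abs.stronglyMeasurable
  set B := Real.exp ((‖z‖ * Q + 1) ^ 2 / (2 * (a - a'))) with hB
  have hmom : ∀ n : ℕ, ∫ x, ‖nearIntegrand r q η z (n + 1) x‖ * |x| ∂(tiltLaw σ (n + 1) : Measure ℝ)
      ≤ B * C := by
    intro n
    rw [integral_tiltLaw σ (n + 1) (hmeas' _)]
    calc _ ≤ ∑ ω : Config (n + 1), tiltWeight s ω *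
          {x : ℝ | |x| ≤ η * √(n + 1 : ℕ)}.indicator (fun x =>
            B * Real.exp (a * x ^ 2 / 2)) (fluct s ω) :=
          Finset.sum_le_sum fun ω _ => mul_le_mul_of_nonneg_left
            (norm_nearIntegrand_mul_abs_le ha'2 hrη hqη z n.succ_ne_zero _)
            (tiltWeight_nonneg h1.le h2.le ω)
      _ = B * ∑ ω : Config (n + 1) with |fluct s ω| ≤ η * √(n + 1 : ℕ),
            tiltWeight s ω * Real.exp (a * fluct s ω ^ 2 / 2) := by
          rw [Finset.mul_sum, Finset.sum_filter]
          refine Finset.sum_congr rfl fun ω _ => ?_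
          simp only [indicator_apply, mem_ofPred_eq]
          split_ifs <;> ring
      _ ≤ B * C := by
          refine mul_le_mul_of_nonneg_left (le_trans ?_ (hC (n + 1))) (Real.exp_pos _).le
          refine Finset.sum_le_sum_of_subset_of_nonneg (fun ω hω => ?_) fun ω _ _ =>
            mul_nonneg (tiltWeight_nonneg h1.le h2.le ω) (Real.exp_pos _).le
          rw [Finset.mem_filter] at hω ⊢
          exact ⟨hω.1, hω.2.trans (by gcongr)⟩
  have hlim := tendsto_integral_of_tendsto_of_moment_le hconv
    (H := fun n => nearIntegrand r q η z (n + 1))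
    (H₀ := fun x : ℝ => Complex.exp ((2 * r 0 : ℝ) / 2 * x ^ 2 + z * q 0 * x))
    (by fun_prop)
    (fun K V hV => (tendsto_add_atTop_nat 1).eventually
      (tendstoUniformlyOn_nearIntegrand hr hq hη0 z K V hV))
    (fun n => integrable_tiltLaw σ (n + 1) (hmeas (n + 1)))
    (fun n => integrable_tiltLaw σ (n + 1) (hmeas' (n + 1)))
    (integrable_cexp_gaussianReal hvn hbv' _)
    (integrable_cexp_mul_abs_gaussianReal hvn hbv' _) hmom
  rw [← tendsto_add_atTop_iff_nat 1]
  refine hlim.congr fun n => ?_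
  simp only [Function.comp_apply]
  rw [integral_tiltLaw σ (n + 1) (hmeas (n + 1)), Finset.sum_filter]
  refine Finset.sum_congr rfl fun ω _ => ?_
  simp only [nearIntegrand, indicator_apply, mem_ofPred_eq, Complex.real_smul, mul_ite, mul_zero]
  rfl

/-- `c √n ≤ c² / (2d) + d n / 2`, so half of the exponential decay survives and beats the factor `n
+ 1`. -/
theorem tendsto_far_bound (c : ℝ) {d : ℝ} (hd : 0 < d) :
    Tendsto (fun n : ℕ => ((n : ℝ) + 1) * Real.exp (c * √n - d * n)) atTop (𝓝 0) := by
  have h1 : Tendsto (fun n : ℕ => Real.exp (c ^ 2 / (2 * d)) *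
      (((n : ℝ) + 1) * Real.exp (-(d / 2) * n))) atTop (𝓝 0) := by
    have e : ∀ n : ℕ, Real.exp (-(d / 2) * n) = Real.exp (-(d / 2)) ^ n := fun n => by
      rw [← Real.exp_nat_mul, mul_comm]
    have hlt : Real.exp (-(d / 2)) < 1 := by rw [Real.exp_lt_one_iff]; linarith
    have t1 := tendsto_self_mul_const_pow_of_lt_one (Real.exp_pos _).le hlt
    have t2 := tendsto_pow_atTop_nhds_zero_of_lt_one (Real.exp_pos _).le hlt
    have := (t1.add t2).const_mul (Real.exp (c ^ 2 / (2 * d)))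
    simp only [add_zero, mul_zero] at this
    refine this.congr fun n => ?_
    rw [e]; ring
  refine squeeze_zero (fun n => by positivity) (fun n => ?_) h1
  rw [mul_left_comm, ← Real.exp_add]
  refine mul_le_mul_of_nonneg_left ?_ (by positivity)
  rw [Real.exp_le_exp]
  have h2 : c ^ 2 / (2 * d) + -(d / 2) * n - (c * √n - d * n) = (c - d * √n) ^ 2 / (2 * d) := by
    have : (n : ℝ) = √n ^ 2 := (Real.sq_sqrt (Nat.cast_nonneg n)).symm
    rw [show (c - d * √n) ^ 2 = c ^ 2 - 2 * c * d * √n + d ^ 2 * √n ^ 2 by ring, ← this]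
    field_simp
    ring
  have : 0 ≤ (c - d * √n) ^ 2 / (2 * d) := by positivity
  linarith

/-- A gap below the maximum of the rate function away from the maximizer. -/
theorem exists_rate_gap {β h s : ℝ} (hs : s ≠ 0)
    (hmax : ∀ x ∈ Icc (0 : ℝ) 1, x ≠ s → rate β h x < rate β h s) {η : ℝ} (hη : 0 < η)
    (hηs : η ≤ |s|) :
    ∃ d > 0, ∀ x ∈ Icc (-1 : ℝ) 1, η ≤ |(|x| - s)| → rate β h x ≤ rate β h s - d := by
  have hcomp : IsCompact (Icc (0 : ℝ) 1 ∩ {x | η ≤ |x - s|}) :=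
    isCompact_Icc.inter_right (isClosed_le (by fun_prop) (by fun_prop))
  have hne : (Icc (0 : ℝ) 1 ∩ {x | η ≤ |x - s|}).Nonempty :=
    ⟨0, ⟨le_rfl, zero_le_one⟩, by simpa using hηs⟩
  obtain ⟨y, ⟨hy, hyη⟩, hym⟩ := hcomp.exists_isMaxOn hne (continuous_rate β h).continuousOn
  have hys : y ≠ s := by
    rintro rfl
    have : η ≤ |y - y| := hyη
    rw [sub_self, abs_zero] at this
    linarith
  refine ⟨rate β h s - rate β h y, by linarith [hmax y hy hys], fun x hx hxη => ?_⟩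
  have : rate β h |x| ≤ rate β h y := hym ⟨⟨abs_nonneg x, abs_le.mpr hx⟩, hxη⟩
  rw [rate_abs] at this
  linarith

/-- Laplace asymptotics of the sums `gibbsSum`. -/
theorem tendsto_gibbsSum_div {β h s : ℝ} (hs0 : 0 < s) (hs1 : s < 1)
    (hcrit : 4 * β * s ^ 3 + 2 * h * s = halfLogOdds s)
    (hnd : 12 * β * s ^ 2 + 2 * h < 1 / (1 - s ^ 2))
    (hmax : ∀ x ∈ Icc (0 : ℝ) 1, x ≠ s → rate β h x < rate β h s)
    {u q : ℝ → ℝ} (hu : ∀ x, u (-x) = u x) (hq : Continuous q)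
    (huq : ∀ y, u (s + y) = u s + y * q y) (z : ℂ) :
    Tendsto (fun n => gibbsSum β h u (u s) n z / (2 * growth β h s n)) atTop
      (𝓝 (∫ x : ℝ, Complex.exp ((12 * β * s ^ 2 + 2 * h : ℝ) / 2 * x ^ 2 + z * q 0 * x)
        ∂(gaussianReal 0 (1 - s ^ 2).toNNReal))) := by
  have hr0 : 2 * energyRemainder β h s 0 = 12 * β * s ^ 2 + 2 * h := by
    unfold energyRemainder; ring
  obtain ⟨η, hη, hηs, hnear⟩ := exists_tendsto_near (s := s) (by linarith) hs1
    (continuous_energyRemainder β h s) hq (by rw [hr0]; exact hnd) (η₀ := s / 2) (by positivity)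
  rw [hr0] at hnear
  obtain ⟨d, hd, hgap⟩ := exists_rate_gap hs0.ne' hmax hη (by rw [abs_of_pos hs0]; linarith)
  have hucont : Continuous u := by
    have : u = fun x => u s + (x - s) * q (x - s) := by
      ext x; rw [← huq]; congr 1; ring
    rw [this]; fun_prop
  obtain ⟨M, hM⟩ := (isCompact_Icc (a := (-1 : ℝ)) (b := 1)).exists_bound_of_continuousOn
    hucont.continuousOn
  set g : (n : ℕ) → Config n → ℂ := fun n ω =>
    (Real.exp (n * (β * mag ω ^ 4 + h * mag ω ^ 2)) : ℂ) *
      Complex.exp (z * (√n * (u (mag ω) - u s) : ℝ)) with hg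
  -- The last two conditions exclude both wells. For `n ≠ 0` they imply the first, which is the form
  -- needed by `hgap`.
  set far : (n : ℕ) → Finset (Config n) := fun n => Finset.univ.filter fun ω =>
    η ≤ |(|mag ω| - s)| ∧ ¬ |fluct s ω| ≤ η * √n ∧ ¬ |fluct s (-ω)| ≤ η * √n with hfar
  have hnearc : ∀ {n : ℕ}, n ≠ 0 → ∀ ω : Config n, |fluct s ω| ≤ η * √n ↔ |mag ω - s| ≤ η := by
    intro n hn ω
    have hpos : 0 < √(n : ℝ) := lt_of_le_of_ne (Real.sqrt_nonneg _) (sqrt_cast_ne_zero hn).symm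
    unfold fluct
    rw [abs_mul, abs_of_pos hpos, mul_comm, mul_le_mul_iff_left₀ hpos]
  -- Spin flip exchanges the wells and preserves `g`, hence the factor `2`; the wells are disjoint
  -- since `η ≤ s / 2`.
  have hsplit : ∀ {n : ℕ}, n ≠ 0 → ∑ ω, g n ω
      = 2 * ∑ ω : Config n with |fluct s ω| ≤ η * √n, g n ω + ∑ ω ∈ far n, g n ω := by
    intro n hn
    have hge : ∀ ω : Config n, g n (-ω) = g n ω := by
      intro ω
      simp only [hg, mag_neg hn, hu]
      congr 3
      ring_nf
    have hneg : ∑ ω : Config n with |fluct s (-ω)| ≤ η * √n, g n ω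
        = ∑ ω : Config n with |fluct s ω| ≤ η * √n, g n ω := by
      refine Finset.sum_equiv (Equiv.neg _) (fun ω => ?_) fun ω _ => (hge ω).symm
      simp
    rw [← Finset.sum_filter_add_sum_filter_not Finset.univ fun ω : Config n =>
        |fluct s ω| ≤ η * √n,
      ← Finset.sum_filter_add_sum_filter_not (Finset.univ.filter fun ω : Config n =>
        ¬ |fluct s ω| ≤ η * √n) (fun ω : Config n => |fluct s (-ω)| ≤ η * √n),
      Finset.filter_filter, Finset.filter_filter, two_mul, add_assoc]
    congr 2
    · rw [← hneg]
      refine Finset.sum_congr (Finset.filter_congr fun ω _ => ?_) fun _ _ => rfl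
      rw [hnearc hn, hnearc hn, mag_neg hn]
      refine ⟨fun h => h.2, fun h => ⟨fun h' => ?_, h⟩⟩
      have a1 := (abs_le.mp h).1
      have a2 := (abs_le.mp h').1
      linarith
    · refine Finset.sum_congr (Finset.filter_congr fun ω _ => ?_) fun _ _ => rfl
      refine ⟨fun h => ⟨?_, h⟩, fun h => h.2⟩
      rw [hnearc hn, hnearc hn, mag_neg hn, not_le, not_le] at h
      rcases abs_choice (mag ω) with hc | hc <;> rw [hc]
      exacts [h.1.le, h.2.le]
  -- The statistic is bounded, so its factor is at most `exp (O(√n))`, which loses to the decay `exp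
  -- (-d n)` coming from the gap.
  have hfar0 : Tendsto (fun n => (∑ ω ∈ far n, g n ω) / (2 * growth β h s n)) atTop (𝓝 0) := by
    refine squeeze_zero_norm' ?_ (tendsto_far_bound (‖z‖ * (2 * M)) hd)
    filter_upwards [eventually_ne_atTop 0] with n hn
    have hgr := growth_pos β h s n
    have hden : ‖(2 * growth β h s n : ℂ)‖ = 2 * growth β h s n := by
      rw [norm_mul, Complex.norm_real, Complex.norm_ofNat, Real.norm_of_nonneg hgr.le]
    rw [norm_div, hden, div_le_iff₀ (by positivity)]
    have hterm : ∀ ω : Config n, ‖g n ω‖ ≤ Real.exp (‖z‖ * (2 * M) * √n) *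
        Real.exp (n * (β * mag ω ^ 4 + h * mag ω ^ 2)) := by
      intro ω
      simp only [hg]
      rw [norm_mul, Complex.norm_real, Real.norm_of_nonneg (Real.exp_pos _).le, mul_comm,
        Complex.norm_exp, Complex.re_mul_ofReal]
      refine mul_le_mul_of_nonneg_right ?_ (Real.exp_pos _).le
      rw [Real.exp_le_exp]
      refine (le_abs_self _).trans ?_
      rw [abs_mul, abs_mul, abs_of_nonneg (Real.sqrt_nonneg _)]
      have b1 : |u (mag ω) - u s| ≤ 2 * M := by
        have c1 := hM _ (mag_mem_Icc ω)
        have c2 := hM s ⟨by linarith, hs1.le⟩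
        rw [Real.norm_eq_abs] at c1 c2
        exact (abs_sub _ _).trans (by linarith)
      calc _ ≤ ‖z‖ * (√n * (2 * M)) := by
            gcongr
            exact Complex.abs_re_le_norm z
        _ = _ := by ring
    have hcrude := sum_exp_le hn (far n) (fun x => β * x ^ 4 + h * x ^ 2)
      (B := rate β h s - d) fun ω hω =>
        hgap _ (mag_mem_Icc ω) (Finset.mem_filter.mp hω).2.1
    calc _ ≤ ∑ ω ∈ far n, Real.exp (‖z‖ * (2 * M) * √n) *
          Real.exp (n * (β * mag ω ^ 4 + h * mag ω ^ 2)) := norm_sum_le_of_le _ fun ω _ => hterm ω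
      _ ≤ Real.exp (‖z‖ * (2 * M) * √n) * ((n + 1) * (2 ^ n * Real.exp (n * (rate β h s - d)))) := by
          rw [← Finset.mul_sum]
          exact mul_le_mul_of_nonneg_left hcrude (Real.exp_pos _).le
      _ = (n + 1) * Real.exp (‖z‖ * (2 * M) * √n - d * n) * growth β h s n := by
          rw [growth, show (n : ℝ) * (rate β h s - d) = n * rate β h s + -(d * n) by ring,
            sub_eq_add_neg, Real.exp_add, Real.exp_add]
          ring
      _ ≤ _ := by
          refine mul_le_mul_of_nonneg_left ?_ (by positivity)
          linarith
  have hsum := (hnear z).add hfar0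
  rw [add_zero] at hsum
  refine hsum.congr' ?_
  filter_upwards [eventually_ne_atTop 0] with n hn
  have hgr : (growth β h s n : ℂ) ≠ 0 := by exact_mod_cast (growth_pos β h s n).ne'
  have hnear' : ∑ ω : Config n with |fluct s ω| ≤ η * √n, g n ω = growth β h s n *
      ∑ ω : Config n with |fluct s ω| ≤ η * √n, (tiltWeight s ω : ℂ) *
        Complex.exp ((fluct s ω ^ 2 * energyRemainder β h s (fluct s ω * (√n)⁻¹) : ℝ) +
          z * (fluct s ω * q (fluct s ω * (√n)⁻¹) : ℝ)) := by
    rw [Finset.mul_sum]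
    refine Finset.sum_congr rfl fun ω _ => ?_
    simp only [hg]
    rw [exp_energy_eq hs0 hs1 hcrit hn, Complex.exp_add, ← Complex.ofReal_exp]
    have : √n * (u (mag ω) - u s) = fluct s ω * q (fluct s ω * (√n)⁻¹) := by
      rw [fluct_div_sqrt hn, show mag ω = s + (mag ω - s) by ring, huq]
      unfold fluct
      rw [show s + (mag ω - s) - s = mag ω - s by ring]
      ring
    rw [this]
    push_cast
    ring
  have htot : gibbsSum β h u (u s) n z = ∑ ω, g n ω := rfl
  rw [htot, hsplit hn, hnear']
  field_simp

/-- The ratio of the sums `gibbsSum` converges to a Gaussian exponential. -/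
theorem tendsto_gibbsSum_div_gibbsSum {β h s : ℝ} (hs0 : 0 < s) (hs1 : s < 1)
    (hcrit : 4 * β * s ^ 3 + 2 * h * s = halfLogOdds s)
    (hnd : 12 * β * s ^ 2 + 2 * h < 1 / (1 - s ^ 2))
    (hmax : ∀ x ∈ Icc (0 : ℝ) 1, x ≠ s → rate β h x < rate β h s)
    {u q : ℝ → ℝ} (hu : ∀ x, u (-x) = u x) (hq : Continuous q)
    (huq : ∀ y, u (s + y) = u s + y * q y) (z : ℂ) :
    Tendsto (fun n => gibbsSum β h u (u s) n z / gibbsSum β h u (u s) n 0) atTop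
      (𝓝 (Complex.exp
        ((q 0 ^ 2 / (1 / (1 - s ^ 2) - (12 * β * s ^ 2 + 2 * h)) : ℝ) * z ^ 2 / 2))) := by
  have hs : 0 < 1 - s ^ 2 := by nlinarith
  have hvn : (1 - s ^ 2).toNNReal ≠ 0 := by simpa using hs
  have hvc : ((1 - s ^ 2).toNNReal : ℝ) = 1 - s ^ 2 := Real.coe_toNNReal _ hs.le
  obtain ⟨c, hc, hint⟩ := exists_integral_cexp_gaussianReal hvn
    (b := 12 * β * s ^ 2 + 2 * h) (by rw [hvc, ← one_div]; exact hnd)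
  have t1 := tendsto_gibbsSum_div hs0 hs1 hcrit hnd hmax hu hq huq z
  have t2 := tendsto_gibbsSum_div hs0 hs1 hcrit hnd hmax hu hq huq 0
  rw [hint] at t1 t2
  have e2 : c * Complex.exp ((0 * q 0) ^ 2 / (2 * (((1 - s ^ 2).toNNReal : ℝ)⁻¹
      - (12 * β * s ^ 2 + 2 * h) : ℝ))) = c := by simp
  rw [e2] at t2
  have t3 := t1.div t2 hc
  have hκ : ((1 / (1 - s ^ 2) - (12 * β * s ^ 2 + 2 * h) : ℝ) : ℂ) ≠ 0 := by
    have : 1 / (1 - s ^ 2) - (12 * β * s ^ 2 + 2 * h) ≠ 0 := by linarith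
    exact_mod_cast this
  have e1 : c * Complex.exp ((z * q 0) ^ 2 / (2 * (((1 - s ^ 2).toNNReal : ℝ)⁻¹
      - (12 * β * s ^ 2 + 2 * h) : ℝ))) / c = Complex.exp
        ((q 0 ^ 2 / (1 / (1 - s ^ 2) - (12 * β * s ^ 2 + 2 * h)) : ℝ) * z ^ 2 / 2) := by
    rw [mul_div_cancel_left₀ _ hc, hvc, ← one_div, Complex.ofReal_div]
    congr 1
    field_simp
    push_cast
    ring
  rw [e1] at t3
  refine t3.congr fun n => ?_
  have : (growth β h s n : ℂ) ≠ 0 := by exact_mod_cast (growth_pos β h s n).ne'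
  simp only [Pi.div_apply]
  exact div_div_div_cancel_right₀ (mul_ne_zero two_ne_zero this) _ _

/-! ### Convergence in distribution on varying spaces -/

/-- If `X n` converges in distribution to `Z` and `Y n - X n` converges to `0` in probability, then
`Y n` converges in distribution to `Z`, for random variables on varying probability spaces. -/
theorem tendstoInDistribution_of_tendsto_measureReal {Ω : ℕ → Type*} {Ω' : Type*}
    [∀ n, MeasurableSpace (Ω n)] [MeasurableSpace Ω'] {μ : (n : ℕ) → Measure (Ω n)}
    [∀ n, IsProbabilityMeasure (μ n)] {μ' : Measure Ω'} [IsProbabilityMeasure μ']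
    {X Y : (n : ℕ) → Ω n → ℝ} {Z : Ω' → ℝ} (hX : TendstoInDistribution X atTop Z μ μ')
    (hXm : ∀ n, Measurable (X n)) (hYm : ∀ n, Measurable (Y n))
    (h : ∀ ε > 0, Tendsto (fun n => (μ n).real {ω | ε ≤ |Y n ω - X n ω|}) atTop (𝓝 0)) :
    TendstoInDistribution Y atTop Z μ μ' := by
  -- The infinite product space carries all the variables with unchanged laws, so that Slutsky's
  -- theorem on a single space applies.
  have hmp := fun n => measurePreserving_eval_infinitePi μ n
  have hlaw : ∀ W : (n : ℕ) → Ω n → ℝ, (∀ n, Measurable (W n)) → ∀ n,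
      (Measure.infinitePi μ).map (fun ω => W n (ω n)) = (μ n).map (W n) := by
    intro W hW n
    rw [← (hmp n).map_eq, Measure.map_map (hW n) (measurable_pi_apply n)]
    rfl
  have hX' : TendstoInDistribution (fun n (ω : (n : ℕ) → Ω n) => X n (ω n)) atTop Z
      (fun _ => Measure.infinitePi μ) μ' := by
    refine ⟨fun n => ((hXm n).comp (measurable_pi_apply n)).aemeasurable, hX.aemeasurable_limit, ?_⟩
    refine hX.tendsto.congr fun n => ?_
    exact Subtype.ext (hlaw X hXm n).symm
  have hsub : TendstoInMeasure (Measure.infinitePi μ)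
      ((fun n (ω : (n : ℕ) → Ω n) => Y n (ω n)) - fun n ω => X n (ω n)) atTop 0 := by
    rw [tendstoInMeasure_iff_measureReal_norm]
    intro ε hε
    refine (h ε hε).congr fun n => ?_
    have hms : MeasurableSet {ω | ε ≤ |Y n ω - X n ω|} :=
      measurableSet_le measurable_const (((hYm n).sub (hXm n)).abs)
    have := (hmp n).measureReal_preimage hms.nullMeasurableSet
    rw [← this]
    congr 1
    ext ω
    simp
  have hY' := tendstoInDistribution_of_tendstoInMeasure_sub
    (fun n (ω : (n : ℕ) → Ω n) => Y n (ω n)) Z hX' hsub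
    fun n => ((hYm n).comp (measurable_pi_apply n)).aemeasurable
  refine ⟨fun n => (hYm n).aemeasurable, hX.aemeasurable_limit, ?_⟩
  refine hY'.tendsto.congr fun n => ?_
  exact Subtype.ext (hlaw Y hYm n)

/-! ### Minimizers of convex functions -/

/-- A convex function with `J a' < J a` and `a < a'` stays at least `J a` to the left of `a`, and
symmetrically at `b`; minimizers are thereby confined to `(a, b)`. -/
theorem exists_isMin_and_bounds {J : ℝ → ℝ} (hJ : ConvexOn ℝ univ J) (hc : Continuous J)
    {a a' b' b : ℝ} (ha : a < a') (hab : a ≤ b) (hb : b' < b) (hJa : J a' < J a)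
    (hJb : J b' < J b) :
    (∃ t, ∀ t', J t ≤ J t') ∧ ∀ t, (∀ t', J t ≤ J t') → a < t ∧ t < b := by
  have hleft : ∀ t ≤ a, J a ≤ J t := by
    intro t ht
    have := hJ.le_max_of_mem_Icc (mem_univ t) (mem_univ a') (z := a) ⟨ht, ha.le⟩
    exact (le_max_iff.mp this).resolve_right (not_le.mpr hJa)
  have hright : ∀ t, b ≤ t → J b ≤ J t := by
    intro t ht
    have := hJ.le_max_of_mem_Icc (mem_univ b') (mem_univ t) (z := b) ⟨hb.le, ht⟩
    exact (le_max_iff.mp this).resolve_left (not_le.mpr hJb)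
  constructor
  · obtain ⟨x, -, hx⟩ := isCompact_Icc.exists_isMinOn (nonempty_Icc.mpr hab) hc.continuousOn
    refine ⟨x, fun t => ?_⟩
    rcases le_or_gt t a with h1 | h1
    · exact (hx ⟨le_rfl, hab⟩ : J x ≤ J a).trans (hleft t h1)
    rcases le_or_gt b t with h2 | h2
    · exact (hx ⟨hab, le_rfl⟩ : J x ≤ J b).trans (hright t h2)
    · exact hx ⟨h1.le, h2.le⟩
  · intro t ht
    constructor
    · by_contra hcon
      linarith [hleft t (not_lt.mp hcon), ht a']
    · by_contra hcon
      linarith [hright t (not_lt.mp hcon), ht b']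

theorem convexOn_sum_mul_exp {ι : Type*} (S : Finset ι) (w c : ι → ℝ) (hw : ∀ i, 0 ≤ w i) :
    ConvexOn ℝ univ fun t : ℝ => ∑ i ∈ S, w i * Real.exp (t * c i) := by
  refine ⟨convex_univ, fun x _ y _ p q hp hq hpq => ?_⟩
  simp only [smul_eq_mul, Finset.mul_sum]
  rw [← Finset.sum_add_distrib]
  refine Finset.sum_le_sum fun i _ => ?_
  have := convexOn_exp.2 (mem_univ (x * c i)) (mem_univ (y * c i)) hp hq hpq
  simp only [smul_eq_mul] at this
  rw [show (p * x + q * y) * c i = p * (x * c i) + q * (y * c i) by ring]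
  nlinarith [mul_le_mul_of_nonneg_left this (hw i)]

/-- If `M n t → exp (v t² / 2)` pointwise, then, locally uniformly in `y`, the function
`t ↦ M n t * exp (-t v y)` eventually decreases left of `y` and increases right of `y`. -/
theorem eventually_exists_bounds {M : ℕ → ℝ → ℝ} (hM0 : ∀ n t, 0 ≤ M n t) {v : ℝ} (hv : 0 < v)
    (hM : ∀ t, Tendsto (fun n => M n t) atTop (𝓝 (Real.exp (v * t ^ 2 / 2)))) {ε : ℝ} (hε : 0 < ε)
    (K : ℝ) : ∀ᶠ n in atTop, ∀ y, |y| ≤ K → ∃ a a' b' b, y - 2 * ε ≤ a ∧ a < a' ∧ a ≤ b ∧ b' < b ∧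
      b ≤ y + 2 * ε ∧ M n a' * Real.exp (-(a' * (v * y))) < M n a * Real.exp (-(a * (v * y))) ∧
      M n b' * Real.exp (-(b' * (v * y))) < M n b * Real.exp (-(b * (v * y))) := by
  -- Pointwise convergence on a finite grid of mesh `ε` suffices for all `|y| ≤ K` at once. In the
  -- limit the two comparisons below reduce to `j² < (j - 1)² + 2j` and `j² + 2j < (j + 1)²`.
  set N : ℤ := ⌈K / ε⌉ + 1 with hN
  have h1 : ∀ᶠ n in atTop, ∀ j ∈ Finset.Icc (-N) N,
      M n (j * ε) < M n ((j - 1) * ε) * Real.exp (v * ε * (j * ε)) := by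
    rw [Filter.eventually_all_finset]
    intro j _
    refine (hM _).eventually_lt ((hM _).mul_const _) ?_
    rw [← Real.exp_add, Real.exp_lt_exp]
    nlinarith [mul_pos hv (mul_pos hε hε)]
  have h2 : ∀ᶠ n in atTop, ∀ j ∈ Finset.Icc (-N) N,
      M n (j * ε) * Real.exp (v * ε * (j * ε)) < M n ((j + 1) * ε) := by
    rw [Filter.eventually_all_finset]
    intro j _
    refine ((hM _).mul_const _).eventually_lt (hM _) ?_
    rw [← Real.exp_add, Real.exp_lt_exp]
    nlinarith [mul_pos hv (mul_pos hε hε)]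
  filter_upwards [h1, h2] with n h1 h2 y hy
  set j := ⌊y / ε⌋ with hj
  have j1 : j * ε ≤ y := (le_div_iff₀ hε).mp (Int.floor_le (y / ε))
  have j2 : y < (j + 1) * ε := (div_lt_iff₀ hε).mp (Int.lt_floor_add_one (y / ε))
  have hyK : y / ε ≤ K / ε := by gcongr; exact (abs_le.mp hy).2
  have hyK' : -(K / ε) ≤ y / ε := by
    rw [← neg_div]; gcongr; exact (abs_le.mp hy).1
  have hceil := Int.le_ceil (K / ε)
  have c1 : -N ≤ j := by
    rw [hj, Int.le_floor, hN]
    push_cast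
    linarith
  have c2 : j + 1 ≤ N := by
    have : j ≤ ⌈K / ε⌉ := by
      have : (j : ℝ) ≤ ⌈K / ε⌉ := (Int.floor_le _).trans (hyK.trans hceil)
      exact_mod_cast this
    omega
  have k1 := h1 j (Finset.mem_Icc.mpr ⟨c1, by omega⟩)
  have k2 := h2 (j + 1) (Finset.mem_Icc.mpr ⟨by omega, c2⟩)
  push_cast at k2
  -- As `j ε ≤ y < (j + 1) ε`, two grid points on each side of `y` lie within `2 ε`. Passing from
  -- the grid comparison to slope `v y` uses the monotonicity of `exp (v ε ·)`.
  refine ⟨(j - 1) * ε, j * ε, (j + 1) * ε, (j + 1 + 1) * ε, by nlinarith, by nlinarith, by nlinarith,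
    by nlinarith, by nlinarith, ?_, ?_⟩
  · have e : Real.exp (-((j - 1) * ε * (v * y))) =
        Real.exp (v * ε * y) * Real.exp (-(j * ε * (v * y))) := by
      rw [← Real.exp_add]; congr 1; ring
    have hpos := hM0 n ((j - 1) * ε)
    rw [e, ← mul_assoc (M n ((j - 1) * ε))]
    refine mul_lt_mul_of_pos_right (k1.trans_le ?_) (Real.exp_pos _)
    gcongr
  · have e : Real.exp (-((j + 1) * ε * (v * y))) =
        Real.exp (v * ε * y) * Real.exp (-((j + 1 + 1) * ε * (v * y))) := by
      rw [← Real.exp_add]; congr 1; ring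
    rw [e, ← mul_assoc (M n ((j + 1) * ε))]
    refine mul_lt_mul_of_pos_right (lt_of_le_of_lt ?_ k2) (Real.exp_pos _)
    have hpos := hM0 n ((j + 1) * ε)
    gcongr

/-! ### Asymptotic normality of maximum likelihood estimators -/

theorem gibbsProb_pos (n : ℕ) (β h : ℝ) (ω : Config n) : 0 < gibbsProb n β h ω :=
  div_pos (Real.exp_pos _) (partitionFunction_pos n β h)

theorem integral_gibbsMeasure {n : ℕ} {β h : ℝ} {E : Type*} [NormedAddCommGroup E]
    [NormedSpace ℝ E] [CompleteSpace E] (f : Config n → E) :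
    ∫ ω, f ω ∂(gibbsMeasure n β h) = ∑ ω, gibbsProb n β h ω • f ω :=
  integral_weightedMeasure (fun ω => (gibbsProb_pos n β h ω).le) f

theorem sum_gibbsProb_mul_cexp (β h : ℝ) (u : ℝ → ℝ) (c : ℝ) (n : ℕ) (z : ℂ) :
    ∑ ω : Config n, (gibbsProb n β h ω : ℂ) * Complex.exp (z * (√n * (u (mag ω) - c) : ℝ)) =
      gibbsSum β h u c n z / gibbsSum β h u c n 0 := by
  have h0 : gibbsSum β h u c n 0 = (partitionFunction n β h : ℂ) := by
    unfold gibbsSum partitionFunction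
    simp only [zero_mul, Complex.exp_zero, mul_one]
    rw [Complex.ofReal_sum]
    rfl
  rw [h0]
  unfold gibbsSum
  rw [Finset.sum_div]
  refine Finset.sum_congr rfl fun ω _ => ?_
  unfold gibbsProb
  rw [Complex.ofReal_div, div_mul_eq_mul_div]
  rfl

/-- The rescaled fluctuations of the sufficient statistic `u (mag ω)`. -/
def statFluct (u : ℝ → ℝ) (s : ℝ) (n : ℕ) (ω : Config n) : ℝ := √n * (u (mag ω) - u s)

/-- A sequence of exponential families of likelihoods on the configuration spaces: the likelihood
ratios in the local parameter `t = √n (θ - θ₀)` are exponential in the statistic `Y`. -/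
def IsLocalExponentialFamily (w : (n : ℕ) → Config n → ℝ) (L : (n : ℕ) → ℝ → Config n → ℝ) (θ₀ : ℝ)
    (Y : (n : ℕ) → Config n → ℝ) : Prop :=
  ∀ n ≠ 0, ∀ (t : ℝ) (ω : Config n), L n (θ₀ + t * (√n)⁻¹) ω =
    w n ω / ∑ ω', w n ω' * Real.exp (t * (Y n ω' - Y n ω))

/-- If the moment generating functions of the statistic converge to a Gaussian one, then the
maximum likelihood estimator is close to a multiple of the statistic. -/
theorem eventually_abs_estimator_sub_le {w : (n : ℕ) → Config n → ℝ} (hw : ∀ n ω, 0 < w n ω)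
    {L : (n : ℕ) → ℝ → Config n → ℝ} {θ₀ : ℝ} {Y : (n : ℕ) → Config n → ℝ}
    (hL : IsLocalExponentialFamily w L θ₀ Y) {v : ℝ} (hv : 0 < v)
    (hmgf : ∀ t : ℝ, Tendsto (fun n => ∑ ω, w n ω * Real.exp (t * Y n ω)) atTop
      (𝓝 (Real.exp (v * t ^ 2 / 2))))
    {T : (n : ℕ) → Config n → ℝ} (hT : ∀ n, IsMLEstimator (L n) (T n)) {ε : ℝ} (hε : 0 < ε)
    (K : ℝ) : ∀ᶠ n in atTop, ∀ ω : Config n, |Y n ω / v| ≤ K →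
      |√n * (T n ω - θ₀) - Y n ω / v| ≤ 2 * ε := by
  have hM0 : ∀ (n : ℕ) (t : ℝ), 0 ≤ ∑ ω, w n ω * Real.exp (t * Y n ω) := fun n t =>
    Finset.sum_nonneg fun ω _ => mul_nonneg (hw n ω).le (Real.exp_pos _).le
  filter_upwards [eventually_exists_bounds hM0 hv hmgf hε K, eventually_ne_atTop 0] with n hn hn0 ω hω
  have hsq := sqrt_cast_ne_zero hn0
  obtain ⟨a, a', b', b, h1, h2, h3, h4, h5, h6, h7⟩ := hn _ hω
  rw [mul_div_cancel₀ _ hv.ne'] at h6 h7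
  set J : ℝ → ℝ := fun t => ∑ ω', w n ω' * Real.exp (t * (Y n ω' - Y n ω)) with hJ
  have hJM : ∀ t, (∑ ω, w n ω * Real.exp (t * Y n ω)) * Real.exp (-(t * Y n ω)) = J t := by
    intro t
    rw [hJ, Finset.sum_mul]
    refine Finset.sum_congr rfl fun ω' _ => ?_
    rw [mul_assoc, ← Real.exp_add]
    congr 2
    ring
  have hJpos : ∀ t, 0 < J t := fun t =>
    Finset.sum_pos (fun ω' _ => mul_pos (hw n ω') (Real.exp_pos _)) ⟨ω, Finset.mem_univ ω⟩
  rw [hJM, hJM] at h6 h7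
  obtain ⟨⟨t, ht⟩, hmin⟩ := exists_isMin_and_bounds (J := J)
    (convexOn_sum_mul_exp _ _ _ fun ω' => (hw n ω').le) (by rw [hJ]; fun_prop) h2 h3 h4 h6 h7
  have hpar : ∀ θ : ℝ, L n θ ω = w n ω / J (√n * (θ - θ₀)) := by
    intro θ
    rw [← hL n hn0]
    congr 1
    field_simp
    ring
  -- The minimizer of `J` shows that the likelihood attains its maximum, so the estimator is not in
  -- its arbitrary regime.
  have hmle : IsMLE (L n) ω (T n ω) := by
    refine hT n ω ⟨θ₀ + t * (√n)⁻¹, fun θ' => ?_⟩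
    rw [hpar, hpar, show √(n : ℝ) * (θ₀ + t * (√n)⁻¹ - θ₀) = t by field_simp; ring]
    exact div_le_div_of_nonneg_left (hw n ω).le (hJpos _) (ht _)
  obtain ⟨b1, b2⟩ := hmin (√n * (T n ω - θ₀)) fun t' => by
    have := hmle (θ₀ + t' * (√n)⁻¹)
    rw [hpar, hpar, show √(n : ℝ) * (θ₀ + t' * (√n)⁻¹ - θ₀) = t' by field_simp; ring] at this
    exact (div_le_div_iff_of_pos_left (hw n ω) (hJpos _) (hJpos _)).mp this
  exact abs_le.mpr ⟨by linarith, by linarith⟩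

/-- Chernoff bounds at `t = 1` and `t = -1` make `Y` tight; on `|Y| ≤ K` the deterministic estimate
applies. -/
theorem tendsto_measureReal_estimator_sub {β h : ℝ}
    {L : (n : ℕ) → ℝ → Config n → ℝ} {θ₀ : ℝ} {Y : (n : ℕ) → Config n → ℝ}
    (hL : IsLocalExponentialFamily (fun n => gibbsProb n β h) L θ₀ Y) {v : ℝ} (hv : 0 < v)
    (hmgf : ∀ t : ℝ, Tendsto (fun n => ∑ ω, gibbsProb n β h ω * Real.exp (t * Y n ω)) atTop
      (𝓝 (Real.exp (v * t ^ 2 / 2))))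
    {T : (n : ℕ) → Config n → ℝ} (hT : ∀ n, IsMLEstimator (L n) (T n)) {ε : ℝ} (hε : 0 < ε) :
    Tendsto (fun n => (gibbsMeasure n β h).real {ω | ε ≤ |√n * (T n ω - θ₀) - Y n ω / v|}) atTop
      (𝓝 0) := by
  rw [Metric.tendsto_atTop]
  intro δ hδ
  set D := Real.exp (v * 1 ^ 2 / 2) + Real.exp (v * (-1) ^ 2 / 2) + 1 with hD
  obtain ⟨K, hK⟩ := ((Real.tendsto_exp_neg_atTop_nhds_zero.mul_const D).eventually_lt_const
    (show 0 * D < δ by rwa [zero_mul])).exists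
  have h1 := ((hmgf 1).add (hmgf (-1))).eventually_lt_const (lt_add_one _)
  have h2 := eventually_abs_estimator_sub_le (gibbsProb_pos · β h) hL hv hmgf hT
    (ε := ε / 4) (by positivity) (K / v)
  obtain ⟨N, hN⟩ := eventually_atTop.mp (h1.and h2)
  refine ⟨N, fun n hn => ?_⟩
  obtain ⟨h1, h2⟩ := hN n hn
  rw [dist_zero_right, Real.norm_of_nonneg measureReal_nonneg]
  have hmgf' : ∀ t : ℝ, mgf (Y n) (gibbsMeasure n β h) t
      = ∑ ω, gibbsProb n β h ω * Real.exp (t * Y n ω) := fun t => by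
    unfold mgf; rw [integral_gibbsMeasure]; rfl
  have hint : ∀ t : ℝ, Integrable (fun ω => Real.exp (t * Y n ω)) (gibbsMeasure n β h) :=
    fun t => Integrable.of_finite
  have m1 := measure_ge_le_exp_mul_mgf K zero_le_one (hint 1)
  have m2 := measure_le_le_exp_mul_mgf (-K) (t := -1) (by norm_num) (hint (-1))
  rw [hmgf'] at m1 m2
  have hsub : {ω | ε ≤ |√n * (T n ω - θ₀) - Y n ω / v|} ⊆ {ω | K ≤ Y n ω} ∪ {ω | Y n ω ≤ -K} := by
    intro ω hω
    by_contra hcon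
    rw [mem_union, not_or] at hcon
    have c1 : Y n ω < K := not_le.mp hcon.1
    have c2 : -K < Y n ω := not_le.mp hcon.2
    have := h2 ω (by rw [abs_div, abs_of_pos hv]; gcongr; exact abs_le.mpr ⟨c2.le, c1.le⟩)
    have hω' : ε ≤ |√n * (T n ω - θ₀) - Y n ω / v| := hω
    linarith
  calc _ ≤ _ := measureReal_mono hsub
    _ ≤ _ := measureReal_union_le _ _
    _ ≤ _ := add_le_add m1 m2
    _ = Real.exp (-K) * (∑ ω, gibbsProb n β h ω * Real.exp (1 * Y n ω)
        + ∑ ω, gibbsProb n β h ω * Real.exp (-1 * Y n ω)) := by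
        rw [show -(1 : ℝ) * K = -K by ring, show -(-1 : ℝ) * -K = -K by ring]; ring
    _ ≤ Real.exp (-K) * D := by gcongr
    _ < δ := hK

/-- Asymptotic normality of the maximum likelihood estimator in an exponential family with
sufficient statistic `u (mag ω)`, for parameters at which the rate function has a unique
nondegenerate positive maximizer `s`. -/
theorem convergesToHalfNormalMixture_of_maximizer {β h s : ℝ} (hs0 : 0 < s) (hs1 : s < 1)
    (hcrit : 4 * β * s ^ 3 + 2 * h * s = halfLogOdds s)
    (hnd : 12 * β * s ^ 2 + 2 * h < 1 / (1 - s ^ 2))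
    (hmax : ∀ x ∈ Icc (0 : ℝ) 1, x ≠ s → rate β h x < rate β h s)
    {u q : ℝ → ℝ} (hu : ∀ x, u (-x) = u x) (hq : Continuous q)
    (huq : ∀ y, u (s + y) = u s + y * q y) (hq0 : q 0 ≠ 0) {L : (n : ℕ) → ℝ → Config n → ℝ} {θ₀ : ℝ}
    (hL : IsLocalExponentialFamily (fun n => gibbsProb n β h) L θ₀ (statFluct u s))
    {T : (n : ℕ) → Config n → ℝ} (hT : ∀ n, IsMLEstimator (L n) (T n)) :
    ConvergesToHalfNormalMixture β h fun n ω => √n * (T n ω - θ₀) := by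
  -- Delta method: `q 0` is the derivative of `u` at `s`, and the denominator is minus the second
  -- derivative of the rate there.
  set v := q 0 ^ 2 / (1 / (1 - s ^ 2) - (12 * β * s ^ 2 + 2 * h)) with hvdef
  have hv : 0 < v := div_pos (by positivity) (by linarith)
  have hlim : ∀ z : ℂ, Tendsto (fun n => ∑ ω : Config n, (gibbsProb n β h ω : ℂ) *
      Complex.exp (z * (statFluct u s n ω : ℝ))) atTop (𝓝 (Complex.exp (v * z ^ 2 / 2))) := by
    intro z
    have := tendsto_gibbsSum_div_gibbsSum hs0 hs1 hcrit hnd hmax hu hq huq z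
    refine this.congr fun n => ?_
    rw [← sum_gibbsProb_mul_cexp]
    rfl
  have hmgf : ∀ t : ℝ, Tendsto (fun n => ∑ ω, gibbsProb n β h ω *
      Real.exp (t * statFluct u s n ω)) atTop (𝓝 (Real.exp (v * t ^ 2 / 2))) := by
    intro t
    have := (Complex.continuous_re.tendsto _).comp (hlim t)
    have e : (Complex.exp (v * t ^ 2 / 2)).re = Real.exp (v * t ^ 2 / 2) := by
      rw [← Complex.exp_ofReal_re]; push_cast; rfl
    rw [e] at this
    refine this.congr fun n => ?_
    simp only [Function.comp_apply]
    rw [← Complex.ofReal_re (∑ ω, gibbsProb n β h ω * Real.exp (t * statFluct u s n ω))]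
    push_cast
    rfl
  set v' : ℝ≥0 := Real.toNNReal (1 / v) with hv'
  have hv'c : (v' : ℝ) = 1 / v := Real.coe_toNNReal _ (by positivity)
  have hv'0 : 0 < v' := by rw [← NNReal.coe_pos, hv'c]; positivity
  have hY : TendstoInDistribution (fun n ω => statFluct u s n ω / v) atTop (fun x : ℝ => x)
      (fun n => gibbsMeasure n β h) (gaussianReal 0 v') := by
    refine ⟨fun n => (measurable_of_finite _).aemeasurable, by fun_prop, ?_⟩
    refine ProbabilityMeasure.tendsto_of_tendsto_charFun fun t => ?_
    simp only [ProbabilityMeasure.coe_mk]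
    rw [Measure.map_id', charFun_gaussianReal]
    have := hlim (t / v * Complex.I)
    have e : Complex.exp (v * (t / v * Complex.I) ^ 2 / 2)
        = Complex.exp (t * (0 : ℝ) * Complex.I - v' * t ^ 2 / 2) := by
      have hvc : (v : ℂ) ≠ 0 := by exact_mod_cast hv.ne'
      have : ((v' : ℝ) : ℂ) = 1 / v := by rw [hv'c]; push_cast; rfl
      rw [this, mul_pow, Complex.I_sq]
      congr 1
      field_simp
      push_cast
      ring
    rw [e] at this
    refine this.congr fun n => ?_
    rw [charFun_apply_real, integral_map (measurable_of_finite _).aemeasurable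
      (Continuous.aestronglyMeasurable (by fun_prop)), integral_gibbsMeasure]
    refine Finset.sum_congr rfl fun ω _ => ?_
    rw [Complex.real_smul]
    congr 2
    push_cast
    ring
  have hU : (gaussianReal 0 v') = halfNormalMixture (1 / 2) (1 / 2) v' v' :=
    (halfNormalMixture_half v').symm
  let U : ProbabilityMeasure ℝ := ⟨gaussianReal 0 v', inferInstance⟩
  have hT' : TendstoInDistribution (fun (n : ℕ) (ω : Config n) => √n * (T n ω - θ₀)) atTop (fun x : ℝ => x)
      (fun n => gibbsMeasure n β h) (U : Measure ℝ) :=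
    tendstoInDistribution_of_tendsto_measureReal hY (fun n => measurable_of_finite _)
      (fun n => measurable_of_finite _)
      fun ε hε => tendsto_measureReal_estimator_sub hL hv hmgf hT hε
  exact ⟨1 / 2, 1 / 2, v', v', U, by norm_num, by norm_num, by norm_num, hv'0, hv'0, hU, hT'⟩

/-- A likelihood obtained by adding `t √n u (mag ω)` to the Hamiltonian is a local exponential
family with statistic `statFluct u s`. -/
theorem isLocalExponentialFamily_of_hamiltonian {β h θ₀ : ℝ} (u : ℝ → ℝ) (s : ℝ) (P : ℝ → ℝ × ℝ)
    (hP : ∀ (n : ℕ), n ≠ 0 → ∀ (t : ℝ) (ω : Config n),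
      hamiltonian n (P (θ₀ + t * (√n)⁻¹)).1 (P (θ₀ + t * (√n)⁻¹)).2 ω
        = hamiltonian n β h ω + t * (√n * u (mag ω))) :
    IsLocalExponentialFamily (fun n => gibbsProb n β h)
      (fun n θ => gibbsProb n (P θ).1 (P θ).2) θ₀ (statFluct u s) := by
  intro n hn t ω
  have hZ := (partitionFunction_pos n β h).ne'
  -- The factor `exp (t √n u(mag ω))` is extracted so that it cancels against the numerator of the
  -- likelihood.
  have hsum : partitionFunction n (P (θ₀ + t * (√n)⁻¹)).1 (P (θ₀ + t * (√n)⁻¹)).2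
      = Real.exp (t * (√n * u (mag ω))) * partitionFunction n β h * ∑ ω' : Config n,
        gibbsProb n β h ω' * Real.exp (t * (statFluct u s n ω' - statFluct u s n ω)) := by
    unfold partitionFunction
    rw [Finset.mul_sum]
    refine Finset.sum_congr rfl fun ω' _ => ?_
    rw [hP n hn, gibbsProb, Real.exp_add, show t * (statFluct u s n ω' - statFluct u s n ω)
      = t * (√n * u (mag ω')) - t * (√n * u (mag ω)) by unfold statFluct; ring, Real.exp_sub]
    have : ∑ ω : Config n, Real.exp (hamiltonian n β h ω) ≠ 0 := hZ
    unfold partitionFunction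
    field_simp
  have hS : (∑ ω' : Config n, gibbsProb n β h ω' *
      Real.exp (t * (statFluct u s n ω' - statFluct u s n ω))) ≠ 0 :=
    (Finset.sum_pos (fun ω' _ => mul_pos (gibbsProb_pos n β h ω') (Real.exp_pos _))
      ⟨ω, Finset.mem_univ ω⟩).ne'
  simp only
  rw [gibbsProb, hsum, hP n hn, Real.exp_add]
  conv_rhs => rw [gibbsProb]
  field_simp

theorem mul_sq_sqrt_inv {n : ℕ} (hn : n ≠ 0) (t : ℝ) : (n : ℝ) * (t * (√n)⁻¹) = t * √n := by
  have := sqrt_cast_ne_zero hn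
  have h2 : (n : ℝ) = √n * √n := (Real.mul_self_sqrt (Nat.cast_nonneg n)).symm
  field_simp
  linear_combination t * h2

end FourSpin

end

theorem mainTheorem8 (β h : ℝ) (hβh : (β, h) ∈ FourSpin.regionTwo)
    (betaHat hHat : (n : ℕ) → FourSpin.Config n → ℝ)
    (hbetaHat : ∀ n : ℕ,
      FourSpin.IsMLEstimator (fun b : ℝ => FourSpin.gibbsProb n b h) (betaHat n))
    (hhHat : ∀ n : ℕ,
      FourSpin.IsMLEstimator (fun k : ℝ => FourSpin.gibbsProb n β k) (hHat n)) :
    FourSpin.ConvergesToHalfNormalMixture β h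
        (fun n ω => Real.sqrt (n : ℝ) * (betaHat n ω - β)) ∧
      FourSpin.ConvergesToHalfNormalMixture β h
        (fun n ω => Real.sqrt (n : ℝ) * (hHat n ω - h)) := by
  obtain ⟨s, hs0, hs1, hcrit, hnd, hmax⟩ := FourSpin.exists_unique_maximizer hβh
  constructor
  · refine FourSpin.convergesToHalfNormalMixture_of_maximizer hs0 hs1 hcrit hnd hmax
      -- `q` is the difference quotient of `u` at `s`; `q 0 = 4 s³` is nonzero because `s > 0`.
      (u := fun x => x ^ 4) (q := fun y => 4 * s ^ 3 + 6 * s ^ 2 * y + 4 * s * y ^ 2 + y ^ 3)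
      (fun x => by ring) (by fun_prop) (fun y => by ring) (by simp [hs0.ne'])
      (FourSpin.isLocalExponentialFamily_of_hamiltonian _ s (fun b => (b, h)) ?_) hbetaHat
    intro n hn t ω
    unfold FourSpin.hamiltonian FourSpin.energy FourSpin.mag
    linear_combination (2 * FourSpin.plusFraction ω - 1) ^ 4 * FourSpin.mul_sq_sqrt_inv hn t
  · refine FourSpin.convergesToHalfNormalMixture_of_maximizer hs0 hs1 hcrit hnd hmax
      (u := fun x => x ^ 2) (q := fun y => 2 * s + y)
      (fun x => by ring) (by fun_prop) (fun y => by ring) (by simp [hs0.ne'])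
      (FourSpin.isLocalExponentialFamily_of_hamiltonian _ s (fun k => (β, k)) ?_) hhHat
    intro n hn t ω
    unfold FourSpin.hamiltonian FourSpin.energy FourSpin.mag
    linear_combination (2 * FourSpin.plusFraction ω - 1) ^ 2 * FourSpin.mul_sq_sqrt_inv hn t
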